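/- Let $d\ge 1$, let $S=(S_n)_{n\ge 0}$ be a random walk on $\mathbb Z^d$ started at the origin (partial sums of i.i.d. $\mathbb Z^d$-valued random variables), and let $(Y_z)_{z\in\mathbb Z^d}$ be i.i.d. real random variables, independent of the walk. Put $$Z_n=\sum_{k=0}^{n-1}Y_{S_k},\qquad \ell_n(z)=\#\{0\le k\le n-1: S_k=z\}.$$ Assume: * (Centering) $\mathbb E[Y_0]=0$ and $\mathbb E[Y_0^2]<\infty$. * (Tail) There are $q\in(0,1)$ and a slowly varying $D:(0,\infty)\to(0,\infty)$ with $\log\mathbb P(Y_0>t)\sim -D(t)t^q$ as $t\to\infty$; the map $t\mapsto D(t)t^{q-1}$ is eventually decreasing; and for every $a\in(0,1)$ the limit $\gamma(a)=\lim_{t\to\infty}D(t^{a+o(1)})/D(t)\in(0,\infty)$ exists (the same for every choice of the $o(1)$ term). * (Walk) If $d\le 2$, the walk is recurrent. If $d=1$, $\lim_n n^{-1/2}\,\mathbb E[\ell_n(0)]$ exists in $(0,\infty)$. If $d=2$, $\lim_n (\log n)^{-1}\mathbb E[\ell_n(0)]$ exists in $(0,\infty)$ and $\sup_{k\ge1}k\,\mathbb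 P(S_k=0)<\infty$. Let $(t_n)_{n\ge1}$ be positive numbers such that for some $r$ with $r<\frac{1-q}{4-q}$ if $d=1$ and $r<\frac{1-q}{2}$ if $d\ge2$, one has $t_n\ge n^{-r}$ for all $n\ge 1$; if $d=2$, assume also $t_n^q<n$ for all sufficiently large $n$, so that $\beta_n(t_n)$ below is defined. Let $$\beta_n(t)=\begin{cases} n^{\frac q{q+2}}\,t^{\frac{2q}{q+2}}\bigl(D(nt^2)\,\gamma(\tfrac1{q+2})\bigr)^{\frac1{q+2}},& d=1,\\[2pt] \bigl((q+1)nt\bigr)^{\frac q{q+1}}\bigl(\log\tfrac n{t^q}\bigr)^{-\frac q{q+1}}\bigl(D(nt)\,\gamma(\tfrac1{q+1})\bigr)^{\frac1{q+1}},& d=2,\\[2pt] (nt)^{\frac q{q+1}}\bigl(D(nt)\,\gamma(\tfrac1{q+1})\bigr)^{\frac1{q+1}},& d\ge3. \end{cases}$$ Then for every $\varepsilon>0$, $$\limsup_{n\to\infty}\frac1{\beta_n(t_n)}\log\frac{\mathbb P(Z_n>nt_n)}{\mathbb P(Y_0\ell_n(0)>nt_n(1-\varepsilon))}\le 0$$ and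 $$\liminf_{n\to\infty}\frac1{\beta_n(t_n)}\log\frac{\mathbb P(Z_n>nt_n)}{\mathbb P(Y_0\ell_n(0)>nt_n(1+\varepsilon))}\ge 0.$$ -/

import Mathlib

open MeasureTheory ProbabilityTheory Filter Topology Asymptotics

noncomputable section

namespace RWRS

/-- The position `S_n = X_0 + ... + X_{n-1}` of the walk on `ℤ^d` with increments `X`, started at
the origin. -/
def walk {Ω : Type*} {d : ℕ} (X : ℕ → Ω → (Fin d → ℤ)) (n : ℕ) (ω : Ω) : Fin d → ℤ :=
  ∑ k ∈ Finset.range n, X k ω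

/-- The local time `ℓ_n(z)`: the number of `k ∈ {0, ..., n-1}` with `S_k = z`. -/
def localTime {Ω : Type*} {d : ℕ} (X : ℕ → Ω → (Fin d → ℤ)) (n : ℕ) (z : Fin d → ℤ) (ω : Ω) : ℕ :=
  ((Finset.range n).filter (fun k => walk X k ω = z)).card

/-- The random walk in random scenery `Z_n = Y_{S_0} + ... + Y_{S_{n-1}}`. -/
def rwrs {Ω : Type*} {d : ℕ} (X : ℕ → Ω → (Fin d → ℤ)) (Y : (Fin d → ℤ) → Ω → ℝ)
    (n : ℕ) (ω : Ω) : ℝ :=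
  ∑ k ∈ Finset.range n, Y (walk X k ω) ω

/-- The probabilistic model: `X` are i.i.d. `ℤ^d`-valued increments, `Y` is an i.i.d. real scenery
indexed by `ℤ^d`, and the whole scenery is independent of the whole walk. -/
structure IsModel {Ω : Type*} [MeasurableSpace Ω] (P : Measure Ω) {d : ℕ}
    (X : ℕ → Ω → (Fin d → ℤ)) (Y : (Fin d → ℤ) → Ω → ℝ) : Prop where
  measurable_step : ∀ k, Measurable (X k)
  indep_step : iIndepFun X P
  identDistrib_step : ∀ k, IdentDistrib (X k) (X 0) P P
  measurable_scenery : ∀ z, Measurable (Y z)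
  indep_scenery : iIndepFun Y P
  identDistrib_scenery : ∀ z, IdentDistrib (Y z) (Y 0) P P
  indep_walk_scenery : IndepFun (fun ω k => X k ω) (fun ω z => Y z ω) P

/-- The assumptions on the walk. In dimensions one and two the walk is recurrent and
`E[ℓ_n(0)]`, divided by `√n` respectively `log n`, has a limit in `(0, ∞)`; in dimension two also
`sup_k k P(S_k = 0) < ∞`. Nothing is required in dimension three and higher. -/
structure WalkAssumption {Ω : Type*} [MeasurableSpace Ω] (P : Measure Ω) {d : ℕ}
    (X : ℕ → Ω → (Fin d → ℤ)) : Prop where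
  recurrent : d ≤ 2 → ∀ᵐ ω ∂P, ∃ n : ℕ, 1 ≤ n ∧ walk X n ω = 0
  return_bound : d = 2 → BddAbove (Set.range fun k : ℕ => (k : ℝ) * P.real {ω | walk X k ω = 0})
  limit_one : d = 1 → ∃ K : ℝ, 0 < K ∧
    Tendsto (fun n : ℕ => (n : ℝ) ^ (-(1 / 2) : ℝ) * ∫ ω, (localTime X n 0 ω : ℝ) ∂P)
      atTop (𝓝 K)
  limit_two : d = 2 → ∃ K : ℝ, 0 < K ∧
    Tendsto (fun n : ℕ => 1 / Real.log n * ∫ ω, (localTime X n 0 ω : ℝ) ∂P) atTop (𝓝 K)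

/-- `E[U] = 0` and `E[U^2] < ∞`. -/
structure CenteringAssumption {Ω : Type*} [MeasurableSpace Ω] (P : Measure Ω) (U : Ω → ℝ) :
    Prop where
  memLp : MemLp U 2 P
  mean_zero : ∫ ω, U ω ∂P = 0

/-- `D : (0, ∞) → (0, ∞)` is slowly varying (at infinity). Only the values of `D` on `(0, ∞)` are
relevant. -/
def SlowlyVarying (D : ℝ → ℝ) : Prop :=
  (∀ t, 0 < t → 0 < D t) ∧ ∀ c, 0 < c → Tendsto (fun t => D (c * t) / D t) atTop (𝓝 1)

/-- The tail assumption on a real random variable `U`: `log P(U > t) ∼ -D(t) t^q` with `q ∈ (0,1)`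
and `D` slowly varying, `t ↦ D(t) t^(q-1)` is eventually decreasing, and
`γ(a) = lim D(t^(a + o(1))) / D(t)` exists in `(0, ∞)` for every `a ∈ (0, 1)`. -/
structure TailAssumption {Ω : Type*} [MeasurableSpace Ω] (P : Measure Ω) (U : Ω → ℝ)
    (q : ℝ) (D γ : ℝ → ℝ) : Prop where
  q_pos : 0 < q
  q_lt_one : q < 1
  slowlyVarying : SlowlyVarying D
  tail : (fun t : ℝ => Real.log (P.real {ω | t < U ω})) ~[atTop] (fun t : ℝ => -(D t * t ^ q))
  eventually_decreasing : ∃ T : ℝ, 0 < T ∧ AntitoneOn (fun t : ℝ => D t * t ^ (q - 1)) (Set.Ici T)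
  gamma_pos : ∀ a ∈ Set.Ioo (0 : ℝ) 1, 0 < γ a
  gamma_lim : ∀ a ∈ Set.Ioo (0 : ℝ) 1, ∀ h : ℝ → ℝ, Tendsto h atTop (𝓝 0) →
    Tendsto (fun t : ℝ => D (t ^ (a + h t)) / D t) atTop (𝓝 (γ a))

/-- The exponential scale `β_n(t)` in dimension `d`. -/
def beta (d : ℕ) (q : ℝ) (D γ : ℝ → ℝ) (n : ℕ) (t : ℝ) : ℝ :=
  if d = 1 then
    (n : ℝ) ^ (q / (q + 2)) * t ^ (2 * q / (q + 2)) *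
      (D (n * t ^ 2) * γ (1 / (q + 2))) ^ (1 / (q + 2))
  else if d = 2 then
    ((q + 1) * (n * t)) ^ (q / (q + 1)) * Real.log (n / t ^ q) ^ (-(q / (q + 1))) *
      (D (n * t) * γ (1 / (q + 1))) ^ (1 / (q + 1))
  else
    ((n : ℝ) * t) ^ (q / (q + 1)) * (D (n * t) * γ (1 / (q + 1))) ^ (1 / (q + 1))

/-- The condition on the sequence `(t_n)_{n ≥ 1}` of positive numbers: `t_n ≥ n^(-r)` for all
`n ≥ 1`, for some `r` below the dimension-dependent threshold. In dimension two one needs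
`log (n / t_n^q) > 0` for the scale `β_n(t_n)` to be defined; this is asked for large `n` only. -/
structure DeviationCondition (d : ℕ) (q : ℝ) (t : ℕ → ℝ) : Prop where
  pos : ∀ n, 1 ≤ n → 0 < t n
  lower : ∃ r : ℝ, r < (if d = 1 then (1 - q) / (4 - q) else (1 - q) / 2) ∧
    ∀ n : ℕ, 1 ≤ n → (n : ℝ) ^ (-r) ≤ t n
  scale_defined : d = 2 → ∀ᶠ n : ℕ in atTop, t n ^ q < n

end RWRS

end

/-!
The proof is a one-big-jump argument carried out conditionally on the walk, so that the local times
are a fixed array of weights and only the scenery is random.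

*Lower bound.* On `{Y₀ ℓ_n(0) > n t (1 + ε)}` the sites other than the origin contribute an
independent centred variable with variance at most `n² E[Y₀²]`, and Cantelli's inequality shows that
it stays above `-ε n t` with probability at least a constant times `min (t², 1)`
(`RWRS.path_measure_ge`). As `t ≥ n ^ (-r)` this costs a power of `n`, whose logarithm is negligible
against `β_n`.

*Upper bound.* Let `V` bound all local times and let `y = n t (1 - ε) / V`. Either the scenery
exceeds `y` at one of the at most `n` visited sites, or all values are at most `y`. In the second
case an exponential Chebyshev bound with slope just below `D(y) y ^ (q - 1)` applies, because the
exponential moments of the truncated scenery are then Gaussian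
(`RWRS.TailAssumption.exists_truncated_mgf_le`). The quadratic term is harmless as long as
`D(y) y ^ (q - 1)` is small compared with `t`, and the result is at most `P(Y₀ > y)`, that is,
`P(Y₀ V > n t (1 - ε))`. If `y` lies below a cut-off level `n ^ s`, then already `Y₀ > n ^ s` implies
`Y₀ V > n t (1 - ε)`, so the trivial bound `1` costs only a factor `1 / P(Y₀ > n ^ s)`. Finally the
maximal local time is at most the local time at `0` of the walk restarted at one of `n` times, each
of which is a copy of `ℓ_n(0)`. Altogether
`P(Z_n > n t) ≤ n (n + 1 + 1 / P(Y₀ > n ^ s)) P(Y₀ ℓ_n(0) > n t (1 - ε))`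
(`RWRS.IsModel.exists_measure_rwrs_le`).

*Scale.* The thresholds on `r` say exactly that `s` can be chosen with `r < s (1 - q)`, as the
exponential bound needs, and with `-log P(Y₀ > n ^ s) ≈ n ^ (q s)` of smaller order than `β_n`
(`RWRS.TailAssumption.exists_exponents`). Both sides of the comparison therefore hold up to factors
`exp (o(β_n))` without any information on the tails of the local times. The power bounds on the
slowly varying function `D` used here come from the monotonicity of the tail of `Y₀`.
-/

namespace RWRS

/-! ### Growth of the logarithmic tail -/

/-- A monotone function that eventually grows by a factor of at least `2 ^ a` on each doubling of
its argument dominates every power of exponent below `a`. -/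
theorem eventually_rpow_le_of_doubling {G : ℝ → ℝ} (hG : Monotone G) {a p : ℝ} (ha : 0 ≤ a)
    (hp : p < a) (hpos : ∀ᶠ u in atTop, 0 < G u)
    (h : ∀ᶠ u in atTop, (2 : ℝ) ^ a * G u ≤ G (2 * u)) : ∀ᶠ u in atTop, u ^ p ≤ G u := by
  obtain ⟨T, hT⟩ := eventually_atTop.1 ((hpos.and h).and (eventually_ge_atTop (1 : ℝ)))
  have hT1 : 1 ≤ T := (hT T le_rfl).2
  have hT0 : 0 < T := by linarith
  have hGT : 0 < G T := (hT T le_rfl).1.1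
  have hj : ∀ j : ℕ, ((2 : ℝ) ^ j) ^ a * G T ≤ G (2 ^ j * T) := by
    intro j
    induction j with
    | zero => simp
    | succ j ih =>
      have h1 := (hT (2 ^ j * T) (le_mul_of_one_le_left hT0.le (one_le_pow₀ (by norm_num)))).1.2
      rw [pow_succ, Real.mul_rpow (by positivity) (by norm_num)]
      calc ((2 : ℝ) ^ j) ^ a * 2 ^ a * G T = 2 ^ a * (((2 : ℝ) ^ j) ^ a * G T) := by ring
        _ ≤ 2 ^ a * G (2 ^ j * T) := by gcongr
        _ ≤ G (2 * (2 ^ j * T)) := h1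
        _ = G (2 ^ j * 2 * T) := by congr 1; ring
  have hlow : ∀ u, T ≤ u → (u / (2 * T)) ^ a * G T ≤ G u := by
    intro u hu
    obtain ⟨j, hj1, hj2⟩ := exists_nat_pow_near ((one_le_div hT0).2 hu) (one_lt_two : (1 : ℝ) < 2)
    have h1 : u / (2 * T) ≤ 2 ^ j := by
      rw [div_le_iff₀ (by positivity)]
      rw [div_lt_iff₀ hT0, pow_succ] at hj2
      nlinarith
    have h2 : 2 ^ j * T ≤ u := (le_div_iff₀ hT0).1 hj1
    have h3 : 0 ≤ u / (2 * T) := div_nonneg (by linarith) (by positivity)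
    calc (u / (2 * T)) ^ a * G T ≤ ((2 : ℝ) ^ j) ^ a * G T := by gcongr
      _ ≤ G (2 ^ j * T) := hj j
      _ ≤ G u := hG h2
  have hc : 0 < G T / (2 * T) ^ a := by positivity
  have h1 : Tendsto (fun u : ℝ => u ^ (a - p)) atTop atTop := tendsto_rpow_atTop (by linarith)
  filter_upwards [h1.eventually_ge_atTop (G T / (2 * T) ^ a)⁻¹, eventually_ge_atTop T] with u h2 h3
  have hu : 0 < u := by linarith
  refine le_trans ?_ (hlow u h3)
  rw [Real.div_rpow hu.le (by positivity), show a = p + (a - p) by ring, Real.rpow_add hu,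
    ← show a = p + (a - p) by ring]
  calc u ^ p = u ^ p * ((G T / (2 * T) ^ a)⁻¹ * (G T / (2 * T) ^ a)) := by
        rw [inv_mul_cancel₀ hc.ne', mul_one]
    _ ≤ u ^ p * (u ^ (a - p) * (G T / (2 * T) ^ a)) := by gcongr
    _ = _ := by ring

/-- A monotone function that eventually grows by a factor of at most `2 ^ a` on each doubling of
its argument is dominated by every power of exponent above `a`. -/
theorem eventually_le_rpow_of_doubling {G : ℝ → ℝ} (hG : Monotone G) {a p : ℝ} (ha : 0 ≤ a)
    (hp : a < p) (hpos : ∀ᶠ u in atTop, 0 < G u)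
    (h : ∀ᶠ u in atTop, G (2 * u) ≤ (2 : ℝ) ^ a * G u) : ∀ᶠ u in atTop, G u ≤ u ^ p := by
  obtain ⟨T, hT⟩ := eventually_atTop.1 ((hpos.and h).and (eventually_ge_atTop (1 : ℝ)))
  have hT1 : 1 ≤ T := (hT T le_rfl).2
  have hT0 : 0 < T := by linarith
  have hGT : 0 < G T := (hT T le_rfl).1.1
  have hj : ∀ j : ℕ, G (2 ^ j * T) ≤ ((2 : ℝ) ^ j) ^ a * G T := by
    intro j
    induction j with
    | zero => simp
    | succ j ih =>
      have h1 := (hT (2 ^ j * T) (le_mul_of_one_le_left hT0.le (one_le_pow₀ (by norm_num)))).1.2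
      rw [pow_succ, Real.mul_rpow (by positivity) (by norm_num)]
      calc G (2 ^ j * 2 * T) = G (2 * (2 ^ j * T)) := by congr 1; ring
        _ ≤ 2 ^ a * G (2 ^ j * T) := h1
        _ ≤ 2 ^ a * (((2 : ℝ) ^ j) ^ a * G T) := by gcongr
        _ = _ := by ring
  have hup : ∀ u, T ≤ u → G u ≤ (2 * u / T) ^ a * G T := by
    intro u hu
    obtain ⟨j, hj1, hj2⟩ := exists_nat_pow_near ((one_le_div hT0).2 hu) (one_lt_two : (1 : ℝ) < 2)
    have h1 : (2 : ℝ) ^ (j + 1) ≤ 2 * u / T := by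
      rw [pow_succ, mul_comm, mul_div_assoc]
      linarith
    have h2 : u ≤ 2 ^ (j + 1) * T := ((div_lt_iff₀ hT0).1 hj2).le
    calc G u ≤ G (2 ^ (j + 1) * T) := hG h2
      _ ≤ ((2 : ℝ) ^ (j + 1)) ^ a * G T := hj _
      _ ≤ (2 * u / T) ^ a * G T := by gcongr
  have h1 : Tendsto (fun u : ℝ => u ^ (p - a)) atTop atTop := tendsto_rpow_atTop (by linarith)
  filter_upwards [h1.eventually_ge_atTop ((2 / T) ^ a * G T), eventually_ge_atTop T] with u h2 h3
  have hu : 0 < u := by linarith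
  refine (hup u h3).trans ?_
  rw [show 2 * u / T = 2 / T * u by ring, Real.mul_rpow (by positivity) hu.le,
    show p = (p - a) + a by ring, Real.rpow_add hu]
  calc (2 / T) ^ a * u ^ a * G T = ((2 / T) ^ a * G T) * u ^ a := by ring
    _ ≤ _ := by
      have : 0 < u ^ a := by positivity
      ring_nf at h2 ⊢
      nlinarith

/-- The logarithmic tail `-log P(U > u)`. -/
noncomputable def logTail {Ω : Type*} [MeasurableSpace Ω] (P : Measure Ω) (U : Ω → ℝ) (u : ℝ) : ℝ :=
  -Real.log (P.real {ω | u < U ω})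

namespace TailAssumption

variable {Ω : Type*} [MeasurableSpace Ω] {P : Measure Ω} {U : Ω → ℝ}
  {q : ℝ} {D γ : ℝ → ℝ}

theorem logTail_bounds (h : TailAssumption P U q D γ) {c : ℝ} (hc : 0 < c) :
    ∀ᶠ u in atTop, (1 - c) * (D u * u ^ q) ≤ logTail P U u ∧
      logTail P U u ≤ (1 + c) * (D u * u ^ q) := by
  filter_upwards [h.tail.isLittleO.def hc, eventually_gt_atTop 0] with u hu hu0
  have hD := h.slowlyVarying.1 u hu0
  have hV : 0 < D u * u ^ q := by positivity
  simp only [Pi.sub_apply, norm_neg, Real.norm_eq_abs, abs_of_pos hV] at hu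
  rw [abs_le] at hu
  unfold logTail
  constructor <;> nlinarith [hu.1, hu.2]

theorem eventually_logTail_pos (h : TailAssumption P U q D γ) :
    ∀ᶠ u in atTop, 0 < logTail P U u := by
  filter_upwards [h.logTail_bounds (c := 1 / 2) (by norm_num), eventually_gt_atTop 0] with u hu hu0
  have hD := h.slowlyVarying.1 u hu0
  have hV : 0 < D u * u ^ q := by positivity
  nlinarith [hu.1]

theorem logTail_isEquivalent (h : TailAssumption P U q D γ) :
    logTail P U ~[atTop] fun u => D u * u ^ q := by
  have h1 := h.tail.neg
  simp only [neg_neg] at h1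
  exact h1

theorem tendsto_logTail_two_mul_div (h : TailAssumption P U q D γ) :
    Tendsto (fun u => logTail P U (2 * u) / logTail P U u) atTop (𝓝 (2 ^ q)) := by
  have h2 : Tendsto (fun u : ℝ => 2 * u) atTop atTop := tendsto_id.const_mul_atTop (by norm_num)
  have h1 := (h.logTail_isEquivalent.comp_tendsto h2).div h.logTail_isEquivalent
  refine h1.symm.tendsto_nhds ?_
  have h3 := (h.slowlyVarying.2 2 (by norm_num)).mul_const ((2 : ℝ) ^ q)
  rw [one_mul] at h3
  refine h3.congr' ?_
  filter_upwards [eventually_gt_atTop 0] with u hu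
  have hD := h.slowlyVarying.1 u hu
  simp only [Function.comp_apply, Pi.div_apply]
  rw [Real.mul_rpow (by norm_num) hu.le]
  field_simp

variable [IsProbabilityMeasure P]

theorem tail_pos (h : TailAssumption P U q D γ) (u : ℝ) : 0 < P.real {ω | u < U ω} := by
  obtain ⟨v, hv, huv⟩ := (h.eventually_logTail_pos.and (eventually_ge_atTop u)).exists
  have h1 : 0 < P.real {ω | v < U ω} := by
    refine lt_of_le_of_ne measureReal_nonneg fun h0 => ?_
    simp [logTail, ← h0] at hv
  exact h1.trans_le (measureReal_mono fun ω hω => lt_of_le_of_lt huv hω)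

theorem exp_neg_logTail (h : TailAssumption P U q D γ) (u : ℝ) :
    Real.exp (-logTail P U u) = P.real {ω | u < U ω} := by
  rw [logTail, neg_neg, Real.exp_log (h.tail_pos u)]

theorem logTail_monotone (h : TailAssumption P U q D γ) : Monotone (logTail P U) := by
  intro u v huv
  exact neg_le_neg (Real.log_le_log (h.tail_pos v)
    (measureReal_mono fun ω hω => lt_of_le_of_lt huv hω))

/-- Slow variation of `D` is only a pointwise statement; the monotonicity of the tail upgrades it
to power bounds. -/
theorem eventually_rpow_le_logTail (h : TailAssumption P U q D γ) {p : ℝ} (hp : p < q) :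
    ∀ᶠ u in atTop, u ^ p ≤ logTail P U u := by
  obtain ⟨a, ha1, ha2⟩ := exists_between (max_lt hp h.q_pos)
  refine eventually_rpow_le_of_doubling h.logTail_monotone
    ((le_max_right _ _).trans ha1.le) ((le_max_left _ _).trans_lt ha1) h.eventually_logTail_pos ?_
  have h2 : (2 : ℝ) ^ a < 2 ^ q := Real.rpow_lt_rpow_of_exponent_lt one_lt_two ha2
  filter_upwards [h.tendsto_logTail_two_mul_div.eventually_const_lt h2, h.eventually_logTail_pos]
    with u h3 h4
  exact ((lt_div_iff₀ h4).1 h3).le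

theorem eventually_logTail_le_rpow (h : TailAssumption P U q D γ) {p : ℝ} (hp : q < p) :
    ∀ᶠ u in atTop, logTail P U u ≤ u ^ p := by
  obtain ⟨a, ha1, ha2⟩ := exists_between hp
  refine eventually_le_rpow_of_doubling h.logTail_monotone
    (h.q_pos.le.trans ha1.le) ha2 h.eventually_logTail_pos ?_
  have h2 : (2 : ℝ) ^ q < 2 ^ a := Real.rpow_lt_rpow_of_exponent_lt one_lt_two ha1
  filter_upwards [h.tendsto_logTail_two_mul_div.eventually_lt_const h2, h.eventually_logTail_pos]
    with u h3 h4
  exact ((div_lt_iff₀ h4).1 h3).le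

theorem eventually_rpow_le (h : TailAssumption P U q D γ) {p : ℝ} (hp : p < q) :
    ∀ᶠ u in atTop, u ^ p ≤ D u * u ^ q := by
  obtain ⟨a, ha1, ha2⟩ := exists_between hp
  have h1 : Tendsto (fun u : ℝ => u ^ (a - p)) atTop atTop := tendsto_rpow_atTop (by linarith)
  filter_upwards [h.eventually_rpow_le_logTail ha2, h.logTail_bounds one_pos,
    h1.eventually_ge_atTop 2, eventually_gt_atTop 0] with u h2 h3 h4 h5
  have h6 : u ^ a = u ^ p * u ^ (a - p) := by rw [← Real.rpow_add h5]; congr 1; ring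
  have h7 : 0 < u ^ p := by positivity
  nlinarith [h3.2]

theorem eventually_le_rpow (h : TailAssumption P U q D γ) {p : ℝ} (hp : q < p) :
    ∀ᶠ u in atTop, D u * u ^ q ≤ u ^ p := by
  obtain ⟨a, ha1, ha2⟩ := exists_between hp
  have h1 : Tendsto (fun u : ℝ => u ^ (p - a)) atTop atTop := tendsto_rpow_atTop (by linarith)
  filter_upwards [h.eventually_logTail_le_rpow ha1, h.logTail_bounds (c := 1 / 2) (by norm_num),
    h1.eventually_ge_atTop 2, eventually_gt_atTop 0] with u h2 h3 h4 h5
  have h6 : u ^ p = u ^ a * u ^ (p - a) := by rw [← Real.rpow_add h5]; congr 1; ring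
  have h7 : 0 < u ^ a := by positivity
  nlinarith [h3.1]

end TailAssumption

/-! ### Exponential moments of the truncated scenery -/

theorem exp_le_one_add_add_sq_mul_exp {x B : ℝ} (hB : 0 ≤ B) (hx : x ≤ B) :
    Real.exp x ≤ 1 + x + x ^ 2 * Real.exp B := by
  have h1 : 1 ≤ Real.exp B := Real.one_le_exp hB
  rcases le_total 0 x with h0 | h0
  · have h2 := Complex.norm_exp_sub_sum_le_norm_mul_exp (x : ℂ) 2
    have h3 : Real.exp x - (1 + x) ≤ x ^ 2 * Real.exp x := by
      have h4 : (Complex.exp x - ∑ m ∈ Finset.range 2, (x : ℂ) ^ m / (m.factorial : ℂ))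
          = ((Real.exp x - (1 + x) : ℝ) : ℂ) := by
        simp [Finset.sum_range_succ]
      rw [h4, Complex.norm_real, Complex.norm_real, Real.norm_eq_abs, Real.norm_eq_abs,
        abs_of_nonneg h0] at h2
      exact (le_abs_self _).trans h2
    have h5 : x ^ 2 * Real.exp x ≤ x ^ 2 * Real.exp B := by gcongr
    linarith
  · have h2 : Real.exp x ≤ 1 + x + x ^ 2 := by
      rcases le_total (-1) x with h3 | h3
      · have := Real.abs_exp_sub_one_sub_id_le (x := x) (by rw [abs_le]; constructor <;> linarith)
        linarith [(abs_le.1 this).2]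
      · have := Real.exp_le_one_iff.2 h0
        nlinarith
    nlinarith [sq_nonneg x]

section Truncation

variable {Ω : Type*} [MeasurableSpace Ω] {P : Measure Ω} [IsProbabilityMeasure P] {U : Ω → ℝ}
  {q : ℝ} {D γ : ℝ → ℝ}

theorem TailAssumption.summable_sq_mul_exp_neg_logTail (h : TailAssumption P U q D γ) {c : ℝ}
    (hc : 0 < c) :
    Summable fun k : ℕ => ((k : ℝ) + 1) ^ 2 * Real.exp (-(c * logTail P U k)) := by
  have hlog := (isLittleO_log_rpow_atTop (half_pos h.q_pos)).def (c := c / 4) (by linarith)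
  have h1 := (hlog.and (h.eventually_rpow_le_logTail (half_lt_self h.q_pos))).and
    (eventually_ge_atTop (1 : ℝ))
  have h2 := tendsto_natCast_atTop_atTop.eventually h1
  have hs : Summable fun k : ℕ => (4 : ℝ) * ((k : ℝ) ^ 2)⁻¹ :=
    (Real.summable_nat_pow_inv.2 one_lt_two).mul_left 4
  refine summable_of_isBigO_nat hs (IsBigO.of_bound 1 ?_)
  filter_upwards [h2] with k hk
  obtain ⟨⟨hk1, hk2⟩, hk3⟩ := hk
  have hk0 : (0 : ℝ) < k := by linarith
  rw [Real.norm_of_nonneg (Real.log_nonneg hk3), Real.norm_of_nonneg (by positivity)] at hk1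
  rw [Real.norm_of_nonneg (by positivity), Real.norm_of_nonneg (by positivity), one_mul]
  have h3 : Real.exp (-(c * logTail P U k)) ≤ ((k : ℝ) ^ 4)⁻¹ := by
    rw [← Real.exp_log hk0, ← Real.exp_nat_mul, ← Real.exp_neg, Real.exp_le_exp, Real.exp_log hk0]
    push_cast
    nlinarith
  calc ((k : ℝ) + 1) ^ 2 * Real.exp (-(c * logTail P U k))
      ≤ (2 * (k : ℝ)) ^ 2 * ((k : ℝ) ^ 4)⁻¹ := by gcongr; linarith
    _ = 4 * ((k : ℝ) ^ 2)⁻¹ := by field_simp; norm_num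

/-- Quadratic bound on the exponential moment of the truncated variable, uniform in the truncation
level `y` and in all exponents `a` below the critical slope `D y * y ^ (q - 1)` by a fixed factor.
The linear term has the favourable sign because the mean vanishes. -/
theorem TailAssumption.exists_truncated_mgf_le (h : TailAssumption P U q D γ) (hU : Measurable U)
    (hc : CenteringAssumption P U) {δ : ℝ} (hδ : 0 < δ) (hδ1 : δ < 1) :
    ∃ M T : ℝ, 0 < M ∧ 0 < T ∧ ∀ y, T ≤ y → ∀ a, 0 ≤ a → a ≤ (1 - δ) * (D y * y ^ (q - 1)) →
      ∫⁻ ω, (Set.Iic y).indicator (fun x => ENNReal.ofReal (Real.exp (a * x))) (U ω) ∂P ≤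
        ENNReal.ofReal (Real.exp (M * a ^ 2)) := by
  obtain ⟨T0, hT0, hanti⟩ := h.eventually_decreasing
  obtain ⟨K1, hK1⟩ := eventually_atTop.1 (h.logTail_bounds (c := δ / 8) (by linarith))
  obtain ⟨K, hK⟩ := exists_nat_ge (max (max T0 K1) (max 1 (8 / δ)))
  simp only [max_le_iff] at hK
  obtain ⟨⟨hKT, hKK⟩, hKone, hKδ⟩ := hK
  have hK0 : (0 : ℝ) < K := by linarith
  -- The critical slope at an integer `k ≥ K` stays below the logarithmic tail up to `k + 1`.
  have hslope : ∀ k : ℕ, K ≤ k → (1 - δ) * (D k * (k : ℝ) ^ (q - 1)) * (k + 1) ≤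
      (1 - δ / 2) * logTail P U k := by
    intro k hk
    have hk' : (K : ℝ) ≤ k := by exact_mod_cast hk
    have hk0 : (0 : ℝ) < k := by linarith
    have h1 := (hK1 k (by linarith)).1
    have hV : 0 < D k * (k : ℝ) ^ q := mul_pos (h.slowlyVarying.1 _ hk0) (by positivity)
    have h2 : (D k * (k : ℝ) ^ (q - 1)) * (k + 1) = D k * (k : ℝ) ^ q * (1 + 1 / k) := by
      rw [Real.rpow_sub_one hk0.ne']; field_simp
    have h3 : 1 / (k : ℝ) ≤ δ / 8 := by
      rw [div_le_iff₀ hδ] at hKδ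
      rw [div_le_iff₀ hk0]
      nlinarith
    calc (1 - δ) * (D k * (k : ℝ) ^ (q - 1)) * (k + 1)
        = (1 - δ) * (1 + 1 / k) * (D k * (k : ℝ) ^ q) := by rw [mul_assoc, h2]; ring
      _ ≤ (1 - δ / 2) * (1 - δ / 8) * (D k * (k : ℝ) ^ q) := by
          refine mul_le_mul_of_nonneg_right ?_ hV.le
          nlinarith
      _ ≤ _ := by nlinarith
  set c : ℕ → ℝ := fun k => (k + 1) ^ 2 * Real.exp ((1 - δ / 2) * logTail P U k) with hcdef
  have hc0 : ∀ k, 0 ≤ c k := fun k => by positivity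
  set Φ : Ω → ENNReal := fun ω => ∑' k : ℕ,
    {ω | (k : ℝ) < U ω}.indicator (fun _ => ENNReal.ofReal (c k)) ω with hΦdef
  have hms : ∀ k : ℕ, MeasurableSet {ω | (k : ℝ) < U ω} := fun k =>
    measurableSet_lt measurable_const hU
  have hΦm : Measurable Φ := Measurable.tsum fun k => measurable_const.indicator (hms k)
  have hΦint : ∫⁻ ω, Φ ω ∂P ≠ ⊤ := by
    rw [lintegral_tsum fun k => (measurable_const.indicator (hms k)).aemeasurable]
    have h1 : ∀ k : ℕ, ∫⁻ ω, {ω | (k : ℝ) < U ω}.indicator (fun _ => ENNReal.ofReal (c k)) ω ∂P =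
        ENNReal.ofReal (((k : ℝ) + 1) ^ 2 * Real.exp (-(δ / 2 * logTail P U k))) := by
      intro k
      rw [lintegral_indicator_const (hms k), ← ofReal_measureReal (measure_ne_top _ _),
        ← h.exp_neg_logTail, ← ENNReal.ofReal_mul (hc0 k)]
      congr 1
      rw [hcdef, mul_assoc, ← Real.exp_add]
      congr 2
      ring
    simp_rw [h1]
    exact (h.summable_sq_mul_exp_neg_logTail (half_pos hδ)).tsum_ofReal_ne_top
  have hΦi : Integrable (fun ω => (Φ ω).toReal) P :=
    integrable_toReal_of_lintegral_ne_top hΦm.aemeasurable hΦint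
  have hUi : Integrable U P := hc.memLp.integrable one_le_two
  have hU2 : Integrable (fun ω => U ω ^ 2) P := hc.memLp.integrable_sq
  set A := D K * (K : ℝ) ^ (q - 1) with hA
  have hA0 : 0 < A := mul_pos (h.slowlyVarying.1 _ hK0) (by positivity)
  set C := Real.exp (A * K) with hC
  set M := ∫ ω, (C * U ω ^ 2 + (Φ ω).toReal) ∂P with hM
  have hM0 : 0 ≤ M := integral_nonneg fun ω => by positivity
  refine ⟨M + 1, K, by linarith, hK0, fun y hy a ha hay => ?_⟩
  have hy0 : 0 < y := by linarith
  have hslope_nonneg : 0 ≤ D y * y ^ (q - 1) := (mul_pos (h.slowlyVarying.1 _ hy0) (by positivity)).le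
  have haA : a ≤ A := by
    have := hanti (Set.mem_Ici.2 hKT) (Set.mem_Ici.2 (hKT.trans hy)) hy
    simp only at this
    nlinarith
  have hpt : ∀ᵐ ω ∂P, (Set.Iic y).indicator (fun x => ENNReal.ofReal (Real.exp (a * x))) (U ω) ≤
      ENNReal.ofReal (1 + a * U ω + a ^ 2 * (C * U ω ^ 2 + (Φ ω).toReal)) := by
    filter_upwards [ae_lt_top hΦm hΦint] with ω hω
    by_cases hUy : U ω ≤ y
    swap
    · rw [Set.indicator_of_notMem (by simpa using hUy)]; exact zero_le
    rw [Set.indicator_of_mem (by simpa using hUy)]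
    refine ENNReal.ofReal_le_ofReal ?_
    have hΦ0 : 0 ≤ (Φ ω).toReal := ENNReal.toReal_nonneg
    rcases le_or_gt (U ω) K with hUK | hUK
    · have h1 : a * U ω ≤ A * K := by
        calc a * U ω ≤ a * K := by gcongr
          _ ≤ A * K := by gcongr
      have h2 := exp_le_one_add_add_sq_mul_exp (by positivity) h1
      have h3 : 0 ≤ a ^ 2 * (Φ ω).toReal := by positivity
      calc _ ≤ _ := h2
        _ ≤ _ := by rw [← hC]; nlinarith
    · have hU0 : 0 < U ω := hK0.trans hUK
      -- `k` is the integer with `k < U ω ≤ k + 1`.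
      obtain ⟨k, hk⟩ : ∃ k, ⌈U ω⌉₊ = k + 1 := Nat.exists_eq_succ_of_ne_zero (Nat.ceil_pos.2 hU0).ne'
      have hk1 : U ω ≤ k + 1 := by
        have := Nat.le_ceil (U ω); rw [hk] at this; exact_mod_cast this
      have hk2 : (k : ℝ) < U ω := Nat.lt_ceil.1 (by omega)
      have hk3 : K ≤ k := by
        have : (K : ℝ) < k + 1 := hUK.trans_le hk1
        have : K < k + 1 := by exact_mod_cast this
        omega
      have hk3' : (K : ℝ) ≤ k := by exact_mod_cast hk3
      have hk0 : (0 : ℝ) < k := by linarith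
      have h1 : a * (k + 1) ≤ (1 - δ / 2) * logTail P U k := by
        refine le_trans ?_ (hslope k hk3)
        have h2 := hanti (Set.mem_Ici.2 (hKT.trans hk3')) (Set.mem_Ici.2 (hKT.trans hy))
          (hk2.le.trans hUy)
        simp only at h2
        have h3 : a ≤ (1 - δ) * (D k * (k : ℝ) ^ (q - 1)) := by nlinarith
        gcongr
      have h2 : a * U ω ≤ a * (k + 1) := by gcongr
      have h3 := exp_le_one_add_add_sq_mul_exp (x := a * U ω) (B := (1 - δ / 2) * logTail P U k)
        (le_trans (by positivity) h1) (h2.trans h1)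
      have h4 : c k ≤ (Φ ω).toReal := by
        rw [← ENNReal.ofReal_le_iff_le_toReal hω.ne]
        refine le_trans ?_ (ENNReal.le_tsum k)
        rw [Set.indicator_of_mem (by exact hk2)]
      have h5 : (U ω) ^ 2 * Real.exp ((1 - δ / 2) * logTail P U k) ≤ c k := by
        rw [hcdef]; dsimp only; gcongr
      have h6 : (a * U ω) ^ 2 * Real.exp ((1 - δ / 2) * logTail P U k) ≤
          a ^ 2 * (C * U ω ^ 2 + (Φ ω).toReal) := by
        rw [mul_pow, mul_assoc]
        have : 0 ≤ C * U ω ^ 2 := by positivity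
        gcongr
        linarith
      linarith
  have hint1 : Integrable (fun ω => C * U ω ^ 2 + (Φ ω).toReal) P := (hU2.const_mul C).add hΦi
  have hint2 : Integrable (fun ω => 1 + a * U ω) P := (integrable_const 1).add (hUi.const_mul a)
  have hint : ∫ ω, (1 + a * U ω + a ^ 2 * (C * U ω ^ 2 + (Φ ω).toReal)) ∂P = 1 + a ^ 2 * M := by
    rw [integral_add hint2 (hint1.const_mul _), integral_add (integrable_const 1) (hUi.const_mul a),
      integral_const_mul, integral_const_mul, hc.mean_zero]
    simp [hM]
  have hnn : 0 ≤ᵐ[P] fun ω => 1 + a * U ω + a ^ 2 * (C * U ω ^ 2 + (Φ ω).toReal) := by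
    refine Eventually.of_forall fun ω => ?_
    have hC1 : 1 ≤ C := Real.one_le_exp (by positivity)
    have hΦ0 : 0 ≤ (Φ ω).toReal := ENNReal.toReal_nonneg
    have h1 : 0 ≤ a ^ 2 * (Φ ω).toReal := by positivity
    have h2 : (a * U ω) ^ 2 ≤ C * (a * U ω) ^ 2 := le_mul_of_one_le_left (by positivity) hC1
    simp only [Pi.zero_apply]
    nlinarith [sq_nonneg (a * U ω + 1 / 2)]
  calc _ ≤ _ := lintegral_mono_ae hpt
    _ = ENNReal.ofReal (1 + a ^ 2 * M) := by
        rw [← hint]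
        exact (ofReal_integral_eq_lintegral_ofReal (hint2.add (hint1.const_mul _)) hnn).symm
    _ ≤ _ := by
        refine ENNReal.ofReal_le_ofReal ?_
        have := Real.add_one_le_exp ((M + 1) * a ^ 2)
        nlinarith [sq_nonneg a]

end Truncation

/-! ### Estimates along a fixed path -/

/-- Cantelli's inequality: the lower deviations of a centred variable with second moment at most
`B` leave a definite amount of mass. -/
theorem cantelli_lower {Ω : Type*} [MeasurableSpace Ω]
    {P : Measure Ω} [IsProbabilityMeasure P] {W : Ω → ℝ} (hW : MemLp W 2 P) (hm : Measurable W) (hmean : ∫ ω, W ω ∂P = 0)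
    {B s : ℝ} (hB : ∫ ω, W ω ^ 2 ∂P ≤ B) (hs : 0 < s) :
    ENNReal.ofReal (s ^ 2 / (s ^ 2 + B)) ≤ P {ω | -s < W ω} := by
  have hB0 : 0 ≤ B := (integral_nonneg fun ω => sq_nonneg _).trans hB
  have hWi := hW.integrable one_le_two
  have hW2 : Integrable (fun ω => W ω ^ 2) P := hW.integrable_sq
  -- Markov's inequality for `(θ - W) ^ 2`, with the optimal shift `θ = B / s`.
  set θ := B / s with hθ
  have hθ0 : 0 ≤ θ := by positivity
  have hi1 : Integrable (fun ω => θ ^ 2 - 2 * θ * W ω) P :=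
    (integrable_const _).sub (hWi.const_mul _)
  have hint : ∫ ω, (θ - W ω) ^ 2 ∂P ≤ θ ^ 2 + B := by
    have h1 : ∀ ω, (θ - W ω) ^ 2 = θ ^ 2 - 2 * θ * W ω + W ω ^ 2 := fun ω => by ring
    simp_rw [h1]
    rw [integral_add hi1 hW2, integral_sub (integrable_const _) (hWi.const_mul _),
      integral_const_mul, hmean]
    simpa using hB
  have hi2 : Integrable (fun ω => (θ - W ω) ^ 2) P := by
    have h1 : (fun ω => (θ - W ω) ^ 2) = fun ω => θ ^ 2 - 2 * θ * W ω + W ω ^ 2 := by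
      ext ω; ring
    rw [h1]
    exact hi1.add hW2
  have hmk := mul_meas_ge_le_integral_of_nonneg (μ := P)
    (Eventually.of_forall fun ω => sq_nonneg (θ - W ω)) hi2 ((s + θ) ^ 2)
  have hle : P.real {ω | W ω ≤ -s} ≤ P.real {ω | (s + θ) ^ 2 ≤ (θ - W ω) ^ 2} := by
    refine measureReal_mono fun ω hω => ?_
    have hω' : W ω ≤ -s := hω
    have h1 : 0 ≤ s + θ := by positivity
    have h2 : s + θ ≤ θ - W ω := by linarith
    exact pow_le_pow_left₀ h1 h2 2
  have hcompl : P.real {ω | -s < W ω} = 1 - P.real {ω | W ω ≤ -s} := by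
    rw [← probReal_compl_eq_one_sub (measurableSet_le hm measurable_const)]
    congr 1
    ext ω
    simp
  rw [ENNReal.ofReal_le_iff_le_toReal (measure_ne_top _ _)]
  change _ ≤ P.real _
  rw [hcompl]
  have h2 : (s + θ) ^ 2 * P.real {ω | W ω ≤ -s} ≤ θ ^ 2 + B :=
    (mul_le_mul_of_nonneg_left hle (by positivity)).trans (hmk.trans hint)
  have h3 : P.real {ω | W ω ≤ -s} ≤ B / (s ^ 2 + B) := by
    have h4 : (θ ^ 2 + B) = B / (s ^ 2 + B) * (s + θ) ^ 2 := by
      have : s ^ 2 + B ≠ 0 := by positivity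
      rw [hθ]; field_simp; ring
    rw [h4, mul_comm] at h2
    exact le_of_mul_le_mul_right h2 (by positivity)
  have h4 : s ^ 2 / (s ^ 2 + B) = 1 - B / (s ^ 2 + B) := by
    have : s ^ 2 + B ≠ 0 := by positivity
    field_simp; ring
  linarith

section Path

/-- Exponential Chebyshev bound for a sum of independent variables truncated at `y`. -/
theorem measure_truncated_sum_le {Ω ι : Type*} [MeasurableSpace Ω] {P : Measure Ω}
    {Y : ι → Ω → ℝ} (hYm : ∀ z, Measurable (Y z)) (hY : iIndepFun Y P)
    (s : Finset ι) (b c : ι → ℝ) (lam x y : ℝ)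
    (hmgf : ∀ z ∈ s, ∫⁻ ω, (Set.Iic y).indicator
      (fun r => ENNReal.ofReal (Real.exp (lam * b z * r))) (Y z ω) ∂P ≤
        ENNReal.ofReal (Real.exp (c z))) (hlam : 0 ≤ lam) :
    P {ω | x < ∑ z ∈ s, b z * Y z ω ∧ ∀ z ∈ s, Y z ω ≤ y} ≤
      ENNReal.ofReal (Real.exp (∑ z ∈ s, c z - lam * x)) := by
  set g : ι → ℝ → ENNReal := fun z => (Set.Iic y).indicator
    (fun r => ENNReal.ofReal (Real.exp (lam * b z * r))) with hg
  have hgm : ∀ z, Measurable (g z) := fun z =>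
    (ENNReal.measurable_ofReal.comp (Real.measurable_exp.comp
      (measurable_const_mul (lam * b z)))).indicator measurableSet_Iic
  have hind : iIndepFun (fun z ω => g z (Y z ω)) P := hY.comp g hgm
  have hprod := lintegral_prod_eq_prod_lintegral_of_indepFun s (fun z ω => g z (Y z ω)) hind
    fun z => (hgm z).comp (hYm z)
  have hF : Measurable fun ω => ∏ z ∈ s, g z (Y z ω) :=
    Finset.measurable_fun_prod s fun z _ => (hgm z).comp (hYm z)
  have h1 : ENNReal.ofReal (Real.exp (lam * x)) *
      P {ω | x < ∑ z ∈ s, b z * Y z ω ∧ ∀ z ∈ s, Y z ω ≤ y} ≤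
      ENNReal.ofReal (Real.exp (∑ z ∈ s, c z)) := by
    calc _ ≤ ENNReal.ofReal (Real.exp (lam * x)) *
          P {ω | ENNReal.ofReal (Real.exp (lam * x)) ≤ ∏ z ∈ s, g z (Y z ω)} := by
          refine mul_le_mul_right (measure_mono ?_) _
          rintro ω ⟨hω1, hω2⟩
          have h2 : ∏ z ∈ s, g z (Y z ω) =
              ENNReal.ofReal (Real.exp (∑ z ∈ s, lam * b z * Y z ω)) := by
            rw [Real.exp_sum, ENNReal.ofReal_prod_of_nonneg fun z _ => (Real.exp_pos _).le]
            refine Finset.prod_congr rfl fun z hz => ?_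
            exact Set.indicator_of_mem (s := Set.Iic y) (hω2 z hz)
              (fun r => ENNReal.ofReal (Real.exp (lam * b z * r)))
          rw [Set.mem_ofPred_eq, h2]
          refine ENNReal.ofReal_le_ofReal (Real.exp_le_exp.2 ?_)
          simp_rw [mul_assoc, ← Finset.mul_sum]
          gcongr
      _ ≤ ∫⁻ ω, ∏ z ∈ s, g z (Y z ω) ∂P := mul_meas_ge_le_lintegral hF _
      _ = ∏ z ∈ s, ∫⁻ ω, g z (Y z ω) ∂P := hprod
      _ ≤ ∏ z ∈ s, ENNReal.ofReal (Real.exp (c z)) := Finset.prod_le_prod' hmgf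
      _ = _ := by
          rw [Real.exp_sum, ENNReal.ofReal_prod_of_nonneg fun z _ => (Real.exp_pos _).le]
  rw [Real.exp_sub, ENNReal.ofReal_div_of_pos (Real.exp_pos _), ENNReal.le_div_iff_mul_le]
  · rwa [mul_comm]
  · left; simp [Real.exp_pos]
  · left; simp

/-- Number of visits of the path `w` to `z` before time `n`. -/
def visits {ι : Type*} [DecidableEq ι] (w : ℕ → ι) (n : ℕ) (z : ι) : ℕ := ((Finset.range n).filter fun k => w k = z).card

theorem sum_visits {ι : Type*} [DecidableEq ι] (w : ℕ → ι) (n : ℕ) : ∑ z ∈ (Finset.range n).image w, visits w n z = n := by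
  have := Finset.card_eq_sum_card_image w (Finset.range n)
  rw [Finset.card_range] at this
  exact this.symm

theorem sum_comp_eq_sum_visits {ι : Type*} [DecidableEq ι] (w : ℕ → ι) (n : ℕ) (f : ι → ℝ) :
    ∑ k ∈ Finset.range n, f (w k) = ∑ z ∈ (Finset.range n).image w, (visits w n z : ℝ) * f z := by
  rw [Finset.sum_comp f w]
  simp [visits, nsmul_eq_mul]

variable {Ω ι : Type*} [MeasurableSpace Ω] [DecidableEq ι] {P : Measure Ω} [IsProbabilityMeasure P]
  {Y : ι → Ω → ℝ} {U : Ω → ℝ} {q : ℝ} {D γ : ℝ → ℝ}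

/-- One big jump along a fixed path: if no site is visited more than `V` times and
`y = n t (1 - ε) / V` is large with `D y * y ^ (q - 1)` small compared with `t`, then the sum of
the scenery exceeds `n t` essentially only if the scenery exceeds `y` at one of the sites. -/
theorem TailAssumption.exists_path_measure_le_of_large (h : TailAssumption P U q D γ)
    (hU : Measurable U) (hc : CenteringAssumption P U) (hYm : ∀ z, Measurable (Y z))
    (hY : iIndepFun Y P) (hid : ∀ z, IdentDistrib (Y z) U P P) {ε : ℝ} (hε : 0 < ε) (hε1 : ε < 1) :
    ∃ κ T : ℝ, 0 < κ ∧ 0 < T ∧ ∀ (n : ℕ) (t y : ℝ) (w : ℕ → ι) (V : ℕ), 0 < t → 0 < V →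
      (∀ z, visits w n z ≤ V) → n * t * (1 - ε) = y * V → T ≤ y → D y * y ^ (q - 1) ≤ κ * t →
      P {ω | n * t < ∑ k ∈ Finset.range n, Y (w k) ω} ≤ (n + 1) * P {ω | y < U ω} := by
  set δ := ε / 4 with hδ
  have hδ0 : 0 < δ := by positivity
  obtain ⟨M, T1, hM, hT1, hmgf⟩ := h.exists_truncated_mgf_le hU hc hδ0 (by linarith : δ < 1)
  obtain ⟨T2, hT2⟩ := eventually_atTop.1 (h.logTail_bounds hδ0)
  refine ⟨δ / M, max T1 T2, by positivity, lt_max_of_lt_left hT1, ?_⟩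
  intro n t y w V ht hV hvis hyV hy hDy
  have hy0 : 0 < y := hT1.trans_le ((le_max_left _ _).trans hy)
  have hV0 : (0 : ℝ) < V := by exact_mod_cast hV
  set R := (Finset.range n).image w with hR
  have hD : 0 < D y := h.slowlyVarying.1 y hy0
  set B := D y * y ^ (q - 1) with hB
  have hB0 : 0 < B := by positivity
  have hBy : B * y = D y * y ^ q := by
    rw [hB, Real.rpow_sub_one hy0.ne']; field_simp
  set a := (1 - δ) * B with ha
  have ha0 : 0 ≤ a := mul_nonneg (by linarith) hB0.le
  set lam := a / V with hlamdef
  have hlam : 0 ≤ lam := by positivity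
  have hlamV : lam * V = a := by rw [hlamdef]; field_simp
  have htail : ∀ z, P {ω | y < Y z ω} = P {ω | y < U ω} := fun z =>
    (hid z).measure_mem_eq measurableSet_Ioi
  have hsub : {ω | n * t < ∑ k ∈ Finset.range n, Y (w k) ω} ⊆
      (⋃ z ∈ R, {ω | y < Y z ω}) ∪
        {ω | n * t < ∑ z ∈ R, (visits w n z : ℝ) * Y z ω ∧ ∀ z ∈ R, Y z ω ≤ y} := by
    intro ω hω
    by_cases h1 : ∀ z ∈ R, Y z ω ≤ y
    · right
      refine ⟨?_, h1⟩
      rw [← sum_comp_eq_sum_visits w n fun z => Y z ω]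
      exact hω
    · left
      push Not at h1
      obtain ⟨z, hz, hzy⟩ := h1
      exact Set.mem_biUnion hz hzy
  have hfirst : P (⋃ z ∈ R, {ω | y < Y z ω}) ≤ n * P {ω | y < U ω} := by
    calc _ ≤ ∑ z ∈ R, P {ω | y < Y z ω} := measure_biUnion_finset_le _ _
      _ = R.card * P {ω | y < U ω} := by simp [htail]
      _ ≤ n * P {ω | y < U ω} := by
        gcongr
        exact Finset.card_image_le.trans_eq (Finset.card_range n)
  have hsq : ∑ z ∈ R, (visits w n z : ℝ) ^ 2 ≤ V * n := by
    calc ∑ z ∈ R, (visits w n z : ℝ) ^ 2 ≤ ∑ z ∈ R, (V : ℝ) * visits w n z := by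
          refine Finset.sum_le_sum fun z _ => ?_
          rw [sq]
          have : (visits w n z : ℝ) ≤ V := by exact_mod_cast hvis z
          gcongr
      _ = V * n := by
          rw [← Finset.mul_sum]
          congr 1
          exact_mod_cast sum_visits w n
  have hsecond : P {ω | n * t < ∑ z ∈ R, (visits w n z : ℝ) * Y z ω ∧ ∀ z ∈ R, Y z ω ≤ y} ≤
      P {ω | y < U ω} := by
    refine (measure_truncated_sum_le hYm hY R (fun z => (visits w n z : ℝ))
      (fun z => M * (lam * visits w n z) ^ 2) lam (n * t) y (fun z _ => ?_) hlam).trans ?_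
    · have h1 := ((hid z).comp (u := (Set.Iic y).indicator
        (fun r => ENNReal.ofReal (Real.exp (lam * visits w n z * r))))
        ((by fun_prop : Measurable fun r : ℝ =>
          ENNReal.ofReal (Real.exp (lam * visits w n z * r))).indicator
          measurableSet_Iic)).lintegral_eq
      simp only [Function.comp_apply] at h1
      rw [h1]
      refine hmgf y ((le_max_left _ _).trans hy) _ (by positivity) ?_
      calc lam * visits w n z ≤ lam * V := by gcongr; exact hvis z
        _ = _ := hlamV
    · rw [← ofReal_measureReal (measure_ne_top _ _), ← h.exp_neg_logTail]
      refine ENNReal.ofReal_le_ofReal (Real.exp_le_exp.2 ?_)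
      have h1 : ∑ z ∈ R, M * (lam * visits w n z) ^ 2 ≤ M * (lam * a * n) := by
        rw [← Finset.mul_sum]
        simp_rw [mul_pow]
        rw [← Finset.mul_sum]
        have : lam ^ 2 * ∑ z ∈ R, (visits w n z : ℝ) ^ 2 ≤ lam ^ 2 * (V * n) := by gcongr
        have h2 : lam ^ 2 * (V * n) = lam * a * n := by rw [← hlamV]; ring
        exact mul_le_mul_of_nonneg_left (this.trans_eq h2) hM.le
      have h2 : M * a ≤ δ * t := by
        have h3 : a ≤ B := by nlinarith
        calc M * a ≤ M * (δ / M * t) := by gcongr; exact h3.trans hDy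
          _ = δ * t := by field_simp
      have h3 : M * (lam * a * n) ≤ δ * (lam * (n * t)) := by
        have : 0 ≤ lam * n := by positivity
        nlinarith
      -- The exponent `lam n t` is `(1 - δ) / (1 - ε)` times `D y * y ^ q`.
      have h4 : lam * (n * t) * (1 - ε) = (1 - δ) * (D y * y ^ q) := by
        rw [← hBy]
        calc lam * (n * t) * (1 - ε) = lam * (n * t * (1 - ε)) := by ring
          _ = lam * V * y := by rw [hyV]; ring
          _ = _ := by rw [hlamV, ha]; ring
      have h5 := (hT2 y ((le_max_right _ _).trans hy)).2
      have hVq : 0 < D y * y ^ q := by positivity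
      have h6 : (1 + δ) * (D y * y ^ q) ≤ (1 - δ) * (lam * (n * t)) := by
        have h7 : 0 < 1 - ε := by linarith
        refine le_of_mul_le_mul_right ?_ h7
        rw [mul_assoc (1 - δ), h4]
        have : (1 + δ) * (1 - ε) ≤ (1 - δ) * (1 - δ) := by rw [hδ]; nlinarith
        nlinarith
      linarith
  calc _ ≤ _ := measure_mono hsub
    _ ≤ _ := measure_union_le _ _
    _ ≤ n * P {ω | y < U ω} + P {ω | y < U ω} := add_le_add hfirst hsecond
    _ = _ := by ring

/-- The bound for a fixed path without a restriction on its local times: if they are so large that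
the threshold `n t (1 - ε) / V` drops below `y₀`, the event `U > y₀` alone is already sufficient
for `U V > n t (1 - ε)`. -/
theorem TailAssumption.exists_path_measure_le (h : TailAssumption P U q D γ)
    (hU : Measurable U) (hc : CenteringAssumption P U) (hYm : ∀ z, Measurable (Y z))
    (hY : iIndepFun Y P) (hid : ∀ z, IdentDistrib (Y z) U P P) {ε : ℝ} (hε : 0 < ε) (hε1 : ε < 1) :
    ∃ κ T : ℝ, 0 < κ ∧ 0 < T ∧ ∀ (n : ℕ) (t y₀ : ℝ) (w : ℕ → ι) (V : ℕ), 0 < t → 0 < V →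
      (∀ z, visits w n z ≤ V) → T ≤ y₀ → D y₀ * y₀ ^ (q - 1) ≤ κ * t →
      P {ω | n * t < ∑ k ∈ Finset.range n, Y (w k) ω} ≤
        (n + 1 + ENNReal.ofReal (Real.exp (logTail P U y₀))) *
          P {ω | n * t * (1 - ε) < U ω * V} := by
  obtain ⟨κ, T1, hκ, hT1, hmain⟩ := h.exists_path_measure_le_of_large hU hc hYm hY hid hε hε1
  obtain ⟨T0, hT0, hanti⟩ := h.eventually_decreasing
  refine ⟨κ, max T1 T0, hκ, lt_max_of_lt_left hT1, ?_⟩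
  intro n t y₀ w V ht hV hvis hy₀ hDy₀
  have hV0 : (0 : ℝ) < V := by exact_mod_cast hV
  set y := n * t * (1 - ε) / V with hy
  have hyV : n * t * (1 - ε) = y * V := by rw [hy]; field_simp
  have hset : {ω | n * t * (1 - ε) < U ω * V} = {ω | y < U ω} := by
    ext ω
    simp only [Set.mem_ofPred_eq, hyV]
    exact mul_lt_mul_iff_left₀ hV0
  rw [hset]
  rcases le_or_gt y₀ y with h1 | h1
  · have h2 := hanti (Set.mem_Ici.2 ((le_max_right _ _).trans hy₀))
      (Set.mem_Ici.2 ((le_max_right _ _).trans (hy₀.trans h1))) h1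
    simp only at h2
    refine (hmain n t y w V ht hV hvis hyV ((le_max_left _ _).trans (hy₀.trans h1))
      (h2.trans hDy₀)).trans ?_
    exact mul_le_mul_left le_self_add _
  · have h2 : ENNReal.ofReal (Real.exp (logTail P U y₀)) * P {ω | y₀ < U ω} = 1 := by
      rw [← ofReal_measureReal (measure_ne_top _ _), ← h.exp_neg_logTail,
        ← ENNReal.ofReal_mul (Real.exp_pos _).le, ← Real.exp_add]
      simp
    calc _ ≤ 1 := prob_le_one
      _ = _ := h2.symm
      _ ≤ _ := by
        refine mul_le_mul' le_add_self (measure_mono fun ω hω => ?_)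
        exact h1.trans hω

/-- Along a fixed path, a large contribution of the site `z₀` forces the sum to be large with a
conditional probability of order at least `min (t ^ 2) 1`: the other sites contribute an
independent centred variable with second moment at most `n ^ 2 E[U ^ 2]`. -/
theorem path_measure_ge (hc : CenteringAssumption P U) (hYm : ∀ z, Measurable (Y z))
    (hY : iIndepFun Y P) (hid : ∀ z, IdentDistrib (Y z) U P P) {ε : ℝ} (hε : 0 < ε)
    {n : ℕ} (hn : 0 < n) {t : ℝ} (ht : 0 < t) (w : ℕ → ι) (z₀ : ι) :
    ENNReal.ofReal ((ε * t) ^ 2 / ((ε * t) ^ 2 + ∫ ω, U ω ^ 2 ∂P)) *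
        P {ω | n * t * (1 + ε) < Y z₀ ω * visits w n z₀} ≤
      P {ω | n * t < ∑ k ∈ Finset.range n, Y (w k) ω} := by
  have hn0 : (0 : ℝ) < n := by exact_mod_cast hn
  set σ := ∫ ω, U ω ^ 2 ∂P with hσ
  have hσ0 : 0 ≤ σ := integral_nonneg fun ω => sq_nonneg _
  set s := (Finset.range n).image w with hs
  set f : ι → Ω → ℝ := fun z ω => (visits w n z : ℝ) * Y z ω with hf
  have hfm : ∀ z, Measurable (f z) := fun z => (hYm z).const_mul _
  have hfi : iIndepFun f P :=
    hY.comp (fun z r => (visits w n z : ℝ) * r) fun z => measurable_const_mul _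
  set F := (Finset.range n).filter fun k => w k ≠ z₀ with hF
  set W : Ω → ℝ := fun ω => ∑ k ∈ F, Y (w k) ω with hW
  have hsplit : ∀ ω, ∑ k ∈ Finset.range n, Y (w k) ω = f z₀ ω + W ω := by
    intro ω
    rw [← Finset.sum_filter_add_sum_filter_not (Finset.range n) fun k => w k = z₀]
    congr 1
    rw [Finset.sum_congr rfl fun k hk => by rw [(Finset.mem_filter.1 hk).2]]
    simp [hf, visits]
  have hWeq : W = ∑ z ∈ s.erase z₀, f z := by
    ext ω
    have h1 : ∑ k ∈ Finset.range n, Y (w k) ω = ∑ z ∈ s, f z ω :=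
      sum_comp_eq_sum_visits w n fun z => Y z ω
    rw [Finset.sum_apply]
    rw [hsplit ω] at h1
    by_cases hz : z₀ ∈ s
    · rw [← Finset.add_sum_erase s _ hz] at h1
      linarith
    · rw [Finset.erase_eq_of_notMem hz]
      have : visits w n z₀ = 0 := by
        simp only [visits, Finset.card_eq_zero, Finset.filter_eq_empty_iff]
        intro k hk hkz
        exact hz (Finset.mem_image.2 ⟨k, hk, hkz⟩)
      simp only [hf, this] at h1 ⊢
      simpa using h1
  have hind : IndepFun W (f z₀) P := by
    rw [hWeq]
    exact hfi.indepFun_finsetSum_of_notMem hfm (Finset.notMem_erase _ _)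
  have hWm : Measurable W := Finset.measurable_fun_sum _ fun k _ => hYm _
  have hmem : ∀ z, MemLp (Y z) 2 P := fun z => (hid z).symm.memLp_iff.1 hc.memLp
  have hW2 : MemLp W 2 P := memLp_finsetSum _ fun k _ => hmem _
  have hmean : ∫ ω, W ω ∂P = 0 := by
    rw [hW, integral_finsetSum _ fun k _ => (hmem _).integrable one_le_two]
    refine Finset.sum_eq_zero fun k _ => ?_
    rw [(hid _).integral_eq, hc.mean_zero]
  have hFn : (F.card : ℝ) ≤ n := by
    exact_mod_cast (Finset.card_filter_le _ _).trans_eq (Finset.card_range n)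
  have hsecond : ∫ ω, W ω ^ 2 ∂P ≤ n ^ 2 * σ := by
    have hi : Integrable (fun ω => F.card * ∑ k ∈ F, Y (w k) ω ^ 2) P :=
      (integrable_finsetSum _ fun k _ => (hmem _).integrable_sq).const_mul _
    calc ∫ ω, W ω ^ 2 ∂P ≤ ∫ ω, F.card * ∑ k ∈ F, Y (w k) ω ^ 2 ∂P :=
          integral_mono hW2.integrable_sq hi fun ω => sq_sum_le_card_mul_sum_sq
      _ = F.card * (F.card * σ) := by
          rw [integral_const_mul, integral_finsetSum _ fun k _ => (hmem _).integrable_sq]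
          have : ∀ k ∈ F, ∫ ω, Y (w k) ω ^ 2 ∂P = σ := fun k _ =>
            ((hid (w k)).comp (u := fun r : ℝ => r ^ 2) (by fun_prop)).integral_eq
          rw [Finset.sum_congr rfl this]
          simp
      _ ≤ n * (n * σ) := by gcongr
      _ = _ := by ring
  have hcant := cantelli_lower hW2 hWm hmean hsecond (s := ε * (n * t)) (by positivity)
  have hfrac : (ε * (n * t)) ^ 2 / ((ε * (n * t)) ^ 2 + n ^ 2 * σ) =
      (ε * t) ^ 2 / ((ε * t) ^ 2 + σ) := by
    have : (ε * t) ^ 2 + σ ≠ 0 := by positivity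
    rw [show (ε * (n * t)) ^ 2 = (n : ℝ) ^ 2 * (ε * t) ^ 2 by ring, ← mul_add,
      mul_div_mul_left _ _ (by positivity)]
  rw [hfrac] at hcant
  calc _ ≤ P {ω | -(ε * (n * t)) < W ω} * P {ω | n * t * (1 + ε) < f z₀ ω} := by
        refine mul_le_mul' hcant (measure_mono fun ω hω => ?_)
        simp only [Set.mem_ofPred_eq, hf] at hω ⊢
        linarith
    _ = P ({ω | -(ε * (n * t)) < W ω} ∩ {ω | n * t * (1 + ε) < f z₀ ω}) :=
        (hind.measure_inter_preimage_eq_mul (Set.Ioi (-(ε * (n * t))))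
          (Set.Ioi (n * t * (1 + ε))) measurableSet_Ioi measurableSet_Ioi).symm
    _ ≤ _ := by
        refine measure_mono fun ω hω => ?_
        simp only [Set.mem_inter_iff, Set.mem_ofPred_eq] at hω ⊢
        rw [hsplit ω]
        linarith [hω.1, hω.2]

end Path

/-! ### Averaging over the walk -/

section Walk

theorem walk_shift {Ω : Type*} {d : ℕ} (X : ℕ → Ω → (Fin d → ℤ)) (k m : ℕ) (ω : Ω) :
    walk X (k + m) ω = walk X k ω + walk (fun j => X (j + k)) m ω := by
  simp only [walk, Finset.sum_range_add]
  exact congrArg _ (Finset.sum_congr rfl fun j _ => by rw [add_comm])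

/-- At the first visit to a most visited site, all local times are at most the local time at the
origin of the walk restarted there. -/
theorem exists_localTime_le_shift {Ω : Type*} {d : ℕ} (X : ℕ → Ω → (Fin d → ℤ)) {n : ℕ} (hn : 0 < n) (ω : Ω) :
    ∃ k ∈ Finset.range n, 0 < localTime (fun j => X (j + k)) n 0 ω ∧
      ∀ z, localTime X n z ω ≤ localTime (fun j => X (j + k)) n 0 ω := by
  obtain ⟨i, hi, hmax⟩ := Finset.exists_max_image (Finset.range n)
    (fun i => localTime X n (walk X i ω) ω) (Finset.nonempty_range_iff.2 hn.ne')
  have hex : ∃ k, walk X k ω = walk X i ω := ⟨i, rfl⟩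
  classical
  set k := Nat.find hex with hk
  have hki : k ≤ i := Nat.find_min' hex rfl
  have hkw : walk X k ω = walk X i ω := Nat.find_spec hex
  have hin : i < n := Finset.mem_range.1 hi
  have hle : localTime X n (walk X i ω) ω ≤ localTime (fun j => X (j + k)) n 0 ω := by
    refine Finset.card_le_card_of_injOn (fun j => j - k) (fun j hj => ?_) ?_
    · have hj' := Finset.mem_filter.1 (Finset.mem_coe.1 hj)
      have hkj : k ≤ j := Nat.find_min' hex hj'.2
      have hjn := Finset.mem_range.1 hj'.1
      refine Finset.mem_coe.2 (Finset.mem_filter.2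
        ⟨Finset.mem_range.2 ((Nat.sub_le j k).trans_lt hjn), ?_⟩)
      have h1 := walk_shift X k (j - k) ω
      rw [Nat.add_sub_cancel' hkj, hj'.2, ← hkw] at h1
      simpa using h1
    · intro a ha b hb hab
      have ha' : k ≤ a := Nat.find_min' hex (Finset.mem_filter.1 (Finset.mem_coe.1 ha)).2
      have hb' : k ≤ b := Nat.find_min' hex (Finset.mem_filter.1 (Finset.mem_coe.1 hb)).2
      simp only at hab
      omega
  refine ⟨k, Finset.mem_range.2 (by omega), lt_of_lt_of_le ?_ hle, fun z => ?_⟩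
  · exact Finset.card_pos.2 ⟨i, Finset.mem_filter.2 ⟨hi, rfl⟩⟩
  · by_cases hz : ∃ j ∈ Finset.range n, walk X j ω = z
    · obtain ⟨j, hj, rfl⟩ := hz
      exact (hmax j hj).trans hle
    · have : localTime X n z ω = 0 := by
        simp only [localTime, Finset.card_eq_zero, Finset.filter_eq_empty_iff]
        exact fun j hj hjz => hz ⟨j, hj, hjz⟩
      rw [this]
      exact Nat.zero_le _

variable {Ω : Type*} [MeasurableSpace Ω] {P : Measure Ω} {d : ℕ}
  {X : ℕ → Ω → (Fin d → ℤ)} {Y : (Fin d → ℤ) → Ω → ℝ}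

theorem measurable_walk (hX : ∀ k, Measurable (X k)) (n : ℕ) : Measurable (walk X n) :=
  Finset.measurable_fun_sum _ fun k _ => hX k

theorem measurable_localTime (hX : ∀ k, Measurable (X k)) (n : ℕ) (z : Fin d → ℤ) :
    Measurable (localTime X n z) := by
  have h1 : localTime X n z = fun ω => ∑ k ∈ Finset.range n, if walk X k ω = z then 1 else 0 := by
    ext ω
    rw [localTime, Finset.card_filter]
  rw [h1]
  refine Finset.measurable_fun_sum _ fun k _ => ?_
  exact Measurable.ite (measurable_walk hX k (measurableSet_singleton z)) measurable_const
    measurable_const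

/-- Integrals of functionals of a local time do not change when the walk is restarted at a
fixed time. -/
theorem IsModel.lintegral_localTime_shift (h : IsModel P X Y) (n k : ℕ) (f : ℕ → ENNReal) :
    ∫⁻ ω, f (localTime (fun j => X (j + k)) n 0 ω) ∂P = ∫⁻ ω, f (localTime X n 0 ω) ∂P := by
  have hmap : P.map (fun ω j => X (j + k) ω) = P.map (fun ω j => X j ω) := by
    rw [h.indep_step.map_fun_eq_infinitePi_map h.measurable_step,
      (h.indep_step.precomp (add_left_injective k)).map_fun_eq_infinitePi_map
        fun j => h.measurable_step _]
    congr 1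
    ext1 j
    exact ((h.identDistrib_step _).trans (h.identDistrib_step _).symm).map_eq
  have hl : Measurable fun x => f (localTime (fun k (x : ℕ → (Fin d → ℤ)) => x k) n 0 x) :=
    measurable_from_top.comp (measurable_localTime (fun k => measurable_pi_apply k) n 0)
  have h1 := lintegral_map (μ := P) hl (measurable_pi_iff.2 fun j => h.measurable_step (j + k))
  have h2 := lintegral_map (μ := P) hl (measurable_pi_iff.2 h.measurable_step)
  rw [← hmap] at h2
  exact h1.symm.trans h2

variable [IsProbabilityMeasure P]

/-- Fubini's theorem for the walk and the independent scenery. -/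
theorem IsModel.measure_eq_lintegral (h : IsModel P X Y)
    {A : Set ((ℕ → (Fin d → ℤ)) × ((Fin d → ℤ) → ℝ))} (hA : MeasurableSet A) :
    P {ω | ((fun k => X k ω), (fun z => Y z ω)) ∈ A} =
      ∫⁻ ω, P {ω' | ((fun k => X k ω), (fun z => Y z ω')) ∈ A} ∂P := by
  have hXm : Measurable fun ω k => X k ω := measurable_pi_iff.2 h.measurable_step
  have hYm : Measurable fun ω z => Y z ω := measurable_pi_iff.2 h.measurable_scenery
  have h1 := (indepFun_iff_map_prod_eq_prod_map_map hXm.aemeasurable hYm.aemeasurable).1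
    h.indep_walk_scenery
  have : IsProbabilityMeasure (P.map fun ω z => Y z ω) :=
    Measure.isProbabilityMeasure_map hYm.aemeasurable
  calc P {ω | ((fun k => X k ω), (fun z => Y z ω)) ∈ A}
      = (P.map fun ω => ((fun k => X k ω), (fun z => Y z ω))) A :=
        (Measure.map_apply (hXm.prodMk hYm) hA).symm
    _ = ∫⁻ x, (P.map fun ω z => Y z ω) (Prod.mk x ⁻¹' A) ∂(P.map fun ω k => X k ω) := by
        rw [h1, Measure.prod_apply hA]
    _ = ∫⁻ ω, (P.map fun ω z => Y z ω) (Prod.mk (fun k => X k ω) ⁻¹' A) ∂P :=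
        lintegral_map (measurable_measure_prodMk_left hA) hXm
    _ = _ := by
        refine lintegral_congr fun ω => ?_
        rw [Measure.map_apply hYm (measurable_prodMk_left hA)]
        rfl

theorem IsModel.measure_rwrs_eq_lintegral (h : IsModel P X Y) (n : ℕ) (x : ℝ) :
    P {ω | x < rwrs X Y n ω} =
      ∫⁻ ω, P {ω' | x < ∑ k ∈ Finset.range n, Y (walk X k ω) ω'} ∂P := by
  have hev : Measurable fun p : (Fin d → ℤ) × ((Fin d → ℤ) → ℝ) => p.2 p.1 :=
    measurable_from_prod_countable_right fun z => measurable_pi_apply z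
  have hw : ∀ k, Measurable (walk (fun k (x : ℕ → (Fin d → ℤ)) => x k) k) :=
    measurable_walk fun k => measurable_pi_apply k
  refine h.measure_eq_lintegral (A := {p | x < ∑ k ∈ Finset.range n,
    p.2 (walk (fun k (x : ℕ → (Fin d → ℤ)) => x k) k p.1)}) ?_
  refine measurableSet_lt measurable_const (Finset.measurable_fun_sum _ fun k _ => ?_)
  exact hev.comp (((hw k).comp measurable_fst).prodMk measurable_snd)

theorem IsModel.measure_mul_localTime_eq_lintegral (h : IsModel P X Y) (n : ℕ) (x : ℝ) :
    P {ω | x < Y 0 ω * localTime X n 0 ω} =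
      ∫⁻ ω, P {ω' | x < Y 0 ω' * localTime X n 0 ω} ∂P := by
  have hl : Measurable (localTime (fun k (x : ℕ → (Fin d → ℤ)) => x k) n 0) :=
    measurable_localTime (fun k => measurable_pi_apply k) n 0
  refine h.measure_eq_lintegral (A := {p | x < p.2 0 *
    (localTime (fun k (x : ℕ → (Fin d → ℤ)) => x k) n 0 p.1 : ℝ)}) ?_
  refine measurableSet_lt measurable_const (Measurable.mul ?_ ?_)
  · exact (measurable_pi_apply 0).comp measurable_snd
  · exact (measurable_from_top (f := fun m : ℕ => (m : ℝ))).comp (hl.comp measurable_fst)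

/-- Upper bound for the random walk in random scenery in terms of a single site, for every
admissible cut-off `y₀`. -/
theorem IsModel.exists_measure_rwrs_le (h : IsModel P X Y) {q : ℝ} {D γ : ℝ → ℝ}
    (hc : CenteringAssumption P (Y 0)) (ht : TailAssumption P (Y 0) q D γ) {ε : ℝ} (hε : 0 < ε)
    (hε1 : ε < 1) :
    ∃ κ T : ℝ, 0 < κ ∧ 0 < T ∧ ∀ (n : ℕ) (t y₀ : ℝ), 0 < n → 0 < t → T ≤ y₀ →
      D y₀ * y₀ ^ (q - 1) ≤ κ * t →
      P.real {ω | n * t < rwrs X Y n ω} ≤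
        n * (n + 1 + Real.exp (logTail P (Y 0) y₀)) *
          P.real {ω | n * t * (1 - ε) < Y 0 ω * localTime X n 0 ω} := by
  obtain ⟨κ, T, hκ, hT, hmain⟩ := ht.exists_path_measure_le (h.measurable_scenery 0) hc
    h.measurable_scenery h.indep_scenery h.identDistrib_scenery hε hε1
  refine ⟨κ, T, hκ, hT, fun n t y₀ hn ht0 hy₀ hD => ?_⟩
  set C : ENNReal := n + 1 + ENNReal.ofReal (Real.exp (logTail P (Y 0) y₀)) with hC
  set g : ℕ → ENNReal := fun V => P {ω | n * t * (1 - ε) < Y 0 ω * V} with hg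
  have hgm : ∀ k, Measurable fun ω => g (localTime (fun j => X (j + k)) n 0 ω) := fun k =>
    (measurable_from_top (f := g)).comp
      (measurable_localTime (fun j => h.measurable_step (j + k)) n 0)
  have hpath : ∀ ω, P {ω' | n * t < ∑ k ∈ Finset.range n, Y (walk X k ω) ω'} ≤
      C * ∑ k ∈ Finset.range n, g (localTime (fun j => X (j + k)) n 0 ω) := by
    intro ω
    obtain ⟨k, hk, hpos, hle⟩ := exists_localTime_le_shift X hn ω
    refine (hmain n t y₀ (fun k => walk X k ω) _ ht0 hpos hle hy₀ hD).trans ?_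
    exact mul_le_mul_right
      (Finset.single_le_sum (f := fun k => g (localTime (fun j => X (j + k)) n 0 ω))
        (fun _ _ => zero_le) hk) C
  have hENN : P {ω | n * t < rwrs X Y n ω} ≤
      n * C * P {ω | n * t * (1 - ε) < Y 0 ω * localTime X n 0 ω} := by
    calc _ = _ := h.measure_rwrs_eq_lintegral n (n * t)
      _ ≤ ∫⁻ ω, C * ∑ k ∈ Finset.range n, g (localTime (fun j => X (j + k)) n 0 ω) ∂P :=
          lintegral_mono hpath
      _ = C * ∑ k ∈ Finset.range n, ∫⁻ ω, g (localTime (fun j => X (j + k)) n 0 ω) ∂P := by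
          rw [lintegral_const_mul _ (Finset.measurable_fun_sum _ fun k _ => hgm k),
            lintegral_finsetSum _ fun k _ => hgm k]
      _ = C * (n * P {ω | n * t * (1 - ε) < Y 0 ω * localTime X n 0 ω}) := by
          rw [h.measure_mul_localTime_eq_lintegral]
          simp_rw [h.lintegral_localTime_shift]
          simp [hg]
      _ = _ := by ring
  have hCr : n * C = ENNReal.ofReal (n * (n + 1 + Real.exp (logTail P (Y 0) y₀))) := by
    rw [ENNReal.ofReal_mul (by positivity), ENNReal.ofReal_add (by positivity) (by positivity),
      ENNReal.ofReal_add (by positivity) (by positivity), hC]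
    simp
  rw [hCr, ← ofReal_measureReal (measure_ne_top _ _), ← ofReal_measureReal (measure_ne_top _ _),
    ← ENNReal.ofReal_mul (by positivity)] at hENN
  exact (ENNReal.ofReal_le_ofReal_iff (by positivity)).1 hENN

theorem IsModel.measure_rwrs_ge (h : IsModel P X Y) (hc : CenteringAssumption P (Y 0)) {ε : ℝ}
    (hε : 0 < ε) {n : ℕ} (hn : 0 < n) {t : ℝ} (ht : 0 < t) :
    (ε * t) ^ 2 / ((ε * t) ^ 2 + ∫ ω, Y 0 ω ^ 2 ∂P) *
        P.real {ω | n * t * (1 + ε) < Y 0 ω * localTime X n 0 ω} ≤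
      P.real {ω | n * t < rwrs X Y n ω} := by
  have hσ : 0 ≤ ∫ ω, Y 0 ω ^ 2 ∂P := integral_nonneg fun ω => sq_nonneg _
  set c := (ε * t) ^ 2 / ((ε * t) ^ 2 + ∫ ω, Y 0 ω ^ 2 ∂P) with hcdef
  have hENN : ENNReal.ofReal c * P {ω | n * t * (1 + ε) < Y 0 ω * localTime X n 0 ω} ≤
      P {ω | n * t < rwrs X Y n ω} := by
    rw [h.measure_mul_localTime_eq_lintegral, h.measure_rwrs_eq_lintegral,
      ← lintegral_const_mul' _ _ ENNReal.ofReal_ne_top]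
    exact lintegral_mono fun ω => path_measure_ge hc h.measurable_scenery h.indep_scenery
      h.identDistrib_scenery hε hn ht (fun k => walk X k ω) 0
  rw [← ofReal_measureReal (measure_ne_top _ _), ← ofReal_measureReal (measure_ne_top _ _),
    ← ENNReal.ofReal_mul (by positivity)] at hENN
  exact (ENNReal.ofReal_le_ofReal_iff (by positivity)).1 hENN

/-- The comparison probabilities are positive: the walk visits the origin at time `0`. -/
theorem TailAssumption.measure_mul_localTime_pos {q : ℝ} {D γ : ℝ → ℝ}
    (ht : TailAssumption P (Y 0) q D γ) {n : ℕ} (hn : 0 < n) (x : ℝ) :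
    0 < P.real {ω | x < Y 0 ω * localTime X n 0 ω} := by
  refine (ht.tail_pos |x|).trans_le (measureReal_mono fun ω hω => ?_)
  have hω' : |x| < Y 0 ω := hω
  have h1 : 1 ≤ localTime X n 0 ω :=
    Finset.card_pos.2 ⟨0, Finset.mem_filter.2 ⟨Finset.mem_range.2 hn, by simp [walk]⟩⟩
  have h2 : (1 : ℝ) ≤ localTime X n 0 ω := by exact_mod_cast h1
  have h3 : 0 ≤ Y 0 ω := (abs_nonneg x).trans hω'.le
  show x < Y 0 ω * localTime X n 0 ω
  nlinarith [le_abs_self x]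

end Walk

/-! ### The size of the exponential scale -/

section Scale

variable {Ω : Type*} [MeasurableSpace Ω] {P : Measure Ω} [IsProbabilityMeasure P] {U : Ω → ℝ}
  {q : ℝ} {D γ : ℝ → ℝ}

theorem TailAssumption.eventually_rpow_le_of_arg (h : TailAssumption P U q D γ) {b p c g : ℝ}
    (hb : 0 < b) (hc : 0 < c) (hg : 0 < g) (hp : p < b * q / c) {u : ℕ → ℝ}
    (hu : ∀ᶠ n : ℕ in atTop, (n : ℝ) ^ b ≤ u n) :
    ∀ᶠ n : ℕ in atTop, (n : ℝ) ^ p ≤ (u n ^ q * (D (u n) * g)) ^ (1 / c) := by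
  have h1 : p * c / b < q := by
    rw [div_lt_iff₀ hb]
    rw [lt_div_iff₀ hc] at hp
    linarith
  obtain ⟨p', hp1, hp2⟩ := exists_between (max_lt h1 h.q_pos)
  have hp0 : 0 < p' := (le_max_right _ _).trans_lt hp1
  have hp3 : p < b * p' / c := by
    have := (le_max_left _ _).trans_lt hp1
    rw [div_lt_iff₀ hb] at this
    rw [lt_div_iff₀ hc]
    linarith
  have hub : Tendsto u atTop atTop := tendsto_atTop_mono' atTop hu
    ((tendsto_rpow_atTop hb).comp tendsto_natCast_atTop_atTop)
  have hlim : Tendsto (fun n : ℕ => (n : ℝ) ^ (b * p' / c - p)) atTop atTop :=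
    (tendsto_rpow_atTop (by linarith)).comp tendsto_natCast_atTop_atTop
  filter_upwards [hub.eventually (h.eventually_rpow_le hp2), hu,
    hlim.eventually_ge_atTop (g ^ (1 / c))⁻¹, eventually_gt_atTop 0] with n h2 h3 h4 h5
  have hn : (0 : ℝ) < n := by exact_mod_cast h5
  have hgc : 0 < g ^ (1 / c) := by positivity
  have h6 : (n : ℝ) ^ (b * p') * g ≤ u n ^ q * (D (u n) * g) := by
    have h7 : (n : ℝ) ^ (b * p') ≤ D (u n) * u n ^ q := by
      rw [Real.rpow_mul hn.le]
      exact le_trans (by gcongr) h2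
    nlinarith
  calc (n : ℝ) ^ p ≤ (n : ℝ) ^ p * ((n : ℝ) ^ (b * p' / c - p) * g ^ (1 / c)) := by
        refine le_mul_of_one_le_right (by positivity) ?_
        rwa [inv_le_iff_one_le_mul₀ hgc] at h4
    _ = (n : ℝ) ^ (b * p' / c) * g ^ (1 / c) := by
        rw [← mul_assoc, ← Real.rpow_add hn]
        congr 2
        ring
    _ = ((n : ℝ) ^ (b * p') * g) ^ (1 / c) := by
        rw [Real.mul_rpow (by positivity) hg.le, ← Real.rpow_mul hn.le]
        congr 2
        ring
    _ ≤ _ := by gcongr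

theorem rpow_le_mul_rpow {n : ℕ} (hn : 0 < n) {t r : ℝ} (h : (n : ℝ) ^ (-r) ≤ t) :
    (n : ℝ) ^ (1 - r) ≤ n * t := by
  have hn0 : (0 : ℝ) < n := by exact_mod_cast hn
  rw [show 1 - r = 1 + -r by ring, Real.rpow_add hn0, Real.rpow_one]
  gcongr

theorem rpow_le_mul_sq {n : ℕ} (hn : 0 < n) {t r : ℝ} (h : (n : ℝ) ^ (-r) ≤ t) :
    (n : ℝ) ^ (1 - 2 * r) ≤ n * t ^ 2 := by
  have hn0 : (0 : ℝ) < n := by exact_mod_cast hn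
  have h1 : (n : ℝ) ^ (1 - 2 * r) = n * ((n : ℝ) ^ (-r)) ^ 2 := by
    rw [show 1 - 2 * r = 1 + -r * 2 by ring, Real.rpow_add hn0, Real.rpow_one,
      Real.rpow_mul hn0.le, Real.rpow_two]
  rw [h1]
  gcongr

theorem TailAssumption.eventually_rpow_le_beta_one (h : TailAssumption P U q D γ) {t : ℕ → ℝ}
    {r p : ℝ} (hr : r < 1 / 2) (ht : ∀ n : ℕ, 1 ≤ n → (n : ℝ) ^ (-r) ≤ t n)
    (hp : p < q * ((1 - 2 * r) / (q + 2))) :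
    ∀ᶠ n : ℕ in atTop, (n : ℝ) ^ p ≤ beta 1 q D γ n (t n) := by
  have hq := h.q_pos
  have hq1 := h.q_lt_one
  have hγ : 0 < γ (1 / (q + 2)) := h.gamma_pos _
    ⟨by positivity, by rw [div_lt_one (by positivity)]; linarith⟩
  have hu : ∀ᶠ n : ℕ in atTop, (n : ℝ) ^ (1 - 2 * r) ≤ n * t n ^ 2 := by
    filter_upwards [eventually_ge_atTop 1] with n hn
    exact rpow_le_mul_sq hn (ht n hn)
  have hp' : p < (1 - 2 * r) * q / (q + 2) := by rw [mul_comm, ← mul_div_assoc'] ; exact hp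
  filter_upwards [h.eventually_rpow_le_of_arg (by linarith) (by linarith : 0 < q + 2) hγ hp' hu,
    eventually_ge_atTop 1] with n h1 hn
  have hn0 : (0 : ℝ) < n := by exact_mod_cast hn
  have ht0 : 0 < t n := lt_of_lt_of_le (by positivity) (ht n hn)
  have hD : 0 < D (n * t n ^ 2) := h.slowlyVarying.1 _ (by positivity)
  refine h1.trans_eq ?_
  rw [beta, if_pos rfl, Real.mul_rpow (by positivity) (by positivity),
    Real.mul_rpow (by positivity) (by positivity), Real.mul_rpow (by positivity) (by positivity),
    ← Real.rpow_mul (by positivity), ← Real.rpow_mul (by positivity), ← Real.rpow_natCast,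
    ← Real.rpow_mul ht0.le]
  congr 3 <;> push_cast <;> ring

theorem TailAssumption.eventually_rpow_le_beta_two (h : TailAssumption P U q D γ) {t : ℕ → ℝ}
    {r p : ℝ} (hr : r < 1) (hr0 : 0 < r) (ht : ∀ n : ℕ, 1 ≤ n → (n : ℝ) ^ (-r) ≤ t n)
    (htn : ∀ᶠ n : ℕ in atTop, t n ^ q < n) (hp : p < q * ((1 - r) / (q + 1))) :
    ∀ᶠ n : ℕ in atTop, (n : ℝ) ^ p ≤ beta 2 q D γ n (t n) := by
  have hq := h.q_pos
  have hq1 := h.q_lt_one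
  have hγ : 0 < γ (1 / (q + 1)) := h.gamma_pos _
    ⟨by positivity, by rw [div_lt_one (by positivity)]; linarith⟩
  have hu : ∀ᶠ n : ℕ in atTop, (n : ℝ) ^ (1 - r) ≤ n * t n := by
    filter_upwards [eventually_ge_atTop 1] with n hn
    exact rpow_le_mul_rpow hn (ht n hn)
  obtain ⟨p', hpp, hp'⟩ := exists_between hp
  replace hp' : p' < (1 - r) * q / (q + 1) := by rw [mul_comm, ← mul_div_assoc']; exact hp'
  have hlog : ∀ᶠ n : ℕ in atTop, Real.log n ≤ 1 / 2 * (n : ℝ) ^ (p' - p) := by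
    have h1 := (isLittleO_log_rpow_atTop (sub_pos.2 hpp)).def (c := 1 / 2) (by norm_num)
    filter_upwards [tendsto_natCast_atTop_atTop.eventually h1] with n hn
    rw [Real.norm_of_nonneg (Real.log_natCast_nonneg n), Real.norm_of_nonneg (by positivity)] at hn
    exact hn
  filter_upwards [h.eventually_rpow_le_of_arg (by linarith) (by linarith : 0 < q + 1) hγ hp' hu,
    eventually_ge_atTop 1, htn, hlog] with n h1 hn htn hlog
  have hn0 : (0 : ℝ) < n := by exact_mod_cast hn
  have hn1 : (1 : ℝ) ≤ n := by exact_mod_cast hn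
  have ht0 : 0 < t n := lt_of_lt_of_le (by positivity) (ht n hn)
  have htq : 0 < t n ^ q := by positivity
  have hD : 0 < D (n * t n) := h.slowlyVarying.1 _ (by positivity)
  have hL0 : 0 < Real.log (n / t n ^ q) := Real.log_pos ((one_lt_div htq).2 htn)
  have hL1 : Real.log (n / t n ^ q) ≤ (n : ℝ) ^ (p' - p) := by
    rw [Real.log_div hn0.ne' htq.ne', Real.log_rpow ht0]
    have h2 : -r * Real.log n ≤ Real.log (t n) := by
      rw [← Real.log_rpow hn0]
      exact Real.log_le_log (by positivity) (ht n hn)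
    have h3 : 0 ≤ Real.log n := Real.log_nonneg hn1
    have h4 : q * (-r * Real.log n) ≤ q * Real.log (t n) := by gcongr
    have h5 : q * r * Real.log n ≤ 1 * Real.log n := by gcongr; nlinarith
    nlinarith
  have hx1 : 1 ≤ (n : ℝ) ^ (p' - p) := Real.one_le_rpow hn1 (by linarith)
  have hfrac : q / (q + 1) ≤ 1 := by rw [div_le_one (by positivity)]; linarith
  have hL : (n : ℝ) ^ (p - p') ≤ Real.log (n / t n ^ q) ^ (-(q / (q + 1))) := by
    rw [Real.rpow_neg hL0.le, ← neg_sub p' p, Real.rpow_neg hn0.le]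
    refine inv_anti₀ (by positivity) ?_
    calc Real.log (n / t n ^ q) ^ (q / (q + 1)) ≤ ((n : ℝ) ^ (p' - p)) ^ (q / (q + 1)) := by gcongr
      _ ≤ ((n : ℝ) ^ (p' - p)) ^ (1 : ℝ) := Real.rpow_le_rpow_of_exponent_le hx1 hfrac
      _ = _ := Real.rpow_one _
  have h2 : ((n * t n) ^ q * (D (n * t n) * γ (1 / (q + 1)))) ^ (1 / (q + 1)) ≤
      ((q + 1) * (n * t n)) ^ (q / (q + 1)) * (D (n * t n) * γ (1 / (q + 1))) ^ (1 / (q + 1)) := by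
    rw [Real.mul_rpow (by positivity) (by positivity), ← Real.rpow_mul (by positivity),
      mul_one_div]
    have h3 : n * t n ≤ (q + 1) * (n * t n) := le_mul_of_one_le_left (by positivity) (by linarith)
    gcongr
  rw [beta, if_neg (by norm_num), if_pos rfl]
  calc (n : ℝ) ^ p = (n : ℝ) ^ (p - p') * (n : ℝ) ^ p' := by
        rw [← Real.rpow_add hn0]; congr 1; ring
    _ ≤ Real.log (n / t n ^ q) ^ (-(q / (q + 1))) * (((q + 1) * (n * t n)) ^ (q / (q + 1)) *
          (D (n * t n) * γ (1 / (q + 1))) ^ (1 / (q + 1))) := by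
        gcongr
        exact h1.trans h2
    _ = _ := by ring

theorem TailAssumption.eventually_rpow_le_beta_of_three_le (h : TailAssumption P U q D γ)
    {d : ℕ} (hd : 3 ≤ d) {t : ℕ → ℝ}
    {r p : ℝ} (hr : r < 1) (ht : ∀ n : ℕ, 1 ≤ n → (n : ℝ) ^ (-r) ≤ t n)
    (hp : p < q * ((1 - r) / (q + 1))) :
    ∀ᶠ n : ℕ in atTop, (n : ℝ) ^ p ≤ beta d q D γ n (t n) := by
  have hq := h.q_pos
  have hq1 := h.q_lt_one
  have hγ : 0 < γ (1 / (q + 1)) := h.gamma_pos _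
    ⟨by positivity, by rw [div_lt_one (by positivity)]; linarith⟩
  have hu : ∀ᶠ n : ℕ in atTop, (n : ℝ) ^ (1 - r) ≤ n * t n := by
    filter_upwards [eventually_ge_atTop 1] with n hn
    exact rpow_le_mul_rpow hn (ht n hn)
  have hp' : p < (1 - r) * q / (q + 1) := by rw [mul_comm, ← mul_div_assoc']; exact hp
  filter_upwards [h.eventually_rpow_le_of_arg (by linarith) (by linarith : 0 < q + 1) hγ hp' hu,
    eventually_ge_atTop 1] with n h1 hn
  have hn0 : (0 : ℝ) < n := by exact_mod_cast hn
  have ht0 : 0 < t n := lt_of_lt_of_le (by positivity) (ht n hn)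
  have hD : 0 < D (n * t n) := h.slowlyVarying.1 _ (by positivity)
  refine h1.trans_eq ?_
  rw [beta, if_neg (by omega), if_neg (by omega), Real.mul_rpow (by positivity) (by positivity),
    ← Real.rpow_mul (by positivity), mul_one_div]

/-- The threshold on `r` is exactly what makes room for a cut-off level `n ^ s` that is high enough
for the exponential Chebyshev bound (`r < s (1 - q)`), while `P(U > n ^ s)`, which is about
`exp (-n ^ (q s))`, is negligible on the scale `beta`. -/
theorem TailAssumption.exists_exponents (h : TailAssumption P U q D γ) {d : ℕ} (hd : 1 ≤ d)
    {t : ℕ → ℝ} (ht : DeviationCondition d q t) :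
    ∃ r s p : ℝ, 0 < r ∧ 0 < s ∧ r < s * (1 - q) ∧ q * s < p ∧
      (∀ n : ℕ, 1 ≤ n → (n : ℝ) ^ (-r) ≤ t n) ∧
      ∀ᶠ n : ℕ in atTop, (n : ℝ) ^ p ≤ beta d q D γ n (t n) := by
  have hq := h.q_pos
  have hq1 := h.q_lt_one
  have hq1' : 0 < 1 - q := by linarith
  obtain ⟨r₀, hr₀, hlow⟩ := ht.lower
  have hthr : 0 < if d = 1 then (1 - q) / (4 - q) else (1 - q) / 2 := by
    split_ifs
    · exact div_pos hq1' (by linarith)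
    · linarith
  obtain ⟨r, hr1, hr2⟩ := exists_between (max_lt hr₀ hthr)
  have hr0 : 0 < r := (le_max_right _ _).trans_lt hr1
  have hlow' : ∀ n : ℕ, 1 ≤ n → (n : ℝ) ^ (-r) ≤ t n := fun n hn =>
    (Real.rpow_le_rpow_of_exponent_le (by exact_mod_cast hn)
      (neg_le_neg ((le_max_left _ _).trans hr1.le))).trans (hlow n hn)
  have hrq : 0 < r / (1 - q) := div_pos hr0 hq1'
  by_cases hd1 : d = 1
  · rw [if_pos hd1, lt_div_iff₀ (by linarith)] at hr2
    have h1 : r / (1 - q) < (1 - 2 * r) / (q + 2) := by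
      rw [div_lt_div_iff₀ hq1' (by linarith)]
      nlinarith
    obtain ⟨s, hs1, hs2⟩ := exists_between h1
    obtain ⟨p, hp1, hp2⟩ := exists_between (mul_lt_mul_of_pos_left hs2 hq)
    refine ⟨r, s, p, hr0, hrq.trans hs1, (div_lt_iff₀ hq1').1 hs1, hp1, hlow', ?_⟩
    subst hd1
    exact h.eventually_rpow_le_beta_one (by nlinarith) hlow' hp2
  · rw [if_neg hd1] at hr2
    have h1 : r / (1 - q) < (1 - r) / (q + 1) := by
      rw [div_lt_div_iff₀ hq1' (by linarith)]
      nlinarith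
    obtain ⟨s, hs1, hs2⟩ := exists_between h1
    obtain ⟨p, hp1, hp2⟩ := exists_between (mul_lt_mul_of_pos_left hs2 hq)
    refine ⟨r, s, p, hr0, hrq.trans hs1, (div_lt_iff₀ hq1').1 hs1, hp1, hlow', ?_⟩
    by_cases hd2 : d = 2
    · have h2 := ht.scale_defined hd2
      subst hd2
      exact h.eventually_rpow_le_beta_two (by linarith) hr0 hlow' h2 hp2
    · exact h.eventually_rpow_le_beta_of_three_le (by omega) (by linarith) hlow' hp2

/-- The critical slope at the cut-off level `n ^ s` is negligible compared with `n ^ (-r)`. -/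
theorem TailAssumption.eventually_slope_le (h : TailAssumption P U q D γ) {r s κ : ℝ} (hs : 0 < s)
    (hrs : r < s * (1 - q)) (hκ : 0 < κ) :
    ∀ᶠ n : ℕ in atTop, D ((n : ℝ) ^ s) * ((n : ℝ) ^ s) ^ (q - 1) ≤ κ * (n : ℝ) ^ (-r) := by
  have h1 : q < 1 - r / s := by
    have : r / s < 1 - q := by rw [div_lt_iff₀ hs]; linarith
    linarith
  obtain ⟨a, ha1, ha2⟩ := exists_between h1
  have hs' : Tendsto (fun n : ℕ => (n : ℝ) ^ s) atTop atTop :=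
    (tendsto_rpow_atTop hs).comp tendsto_natCast_atTop_atTop
  have hpos : 0 < s * (1 - a) - r := by
    have : r / s < 1 - a := by linarith
    rw [div_lt_iff₀ hs] at this
    linarith
  have hlim : Tendsto (fun n : ℕ => (n : ℝ) ^ (s * (1 - a) - r)) atTop atTop :=
    (tendsto_rpow_atTop hpos).comp tendsto_natCast_atTop_atTop
  filter_upwards [hs'.eventually (h.eventually_le_rpow ha1), hlim.eventually_ge_atTop κ⁻¹,
    eventually_gt_atTop 0] with n h2 h3 h4
  have hn : (0 : ℝ) < n := by exact_mod_cast h4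
  have hns : 0 < (n : ℝ) ^ s := by positivity
  rw [inv_le_iff_one_le_mul₀ hκ] at h3
  calc D ((n : ℝ) ^ s) * ((n : ℝ) ^ s) ^ (q - 1)
      = D ((n : ℝ) ^ s) * ((n : ℝ) ^ s) ^ q / (n : ℝ) ^ s := by
        rw [Real.rpow_sub_one hns.ne', mul_div_assoc]
    _ ≤ ((n : ℝ) ^ s) ^ a / (n : ℝ) ^ s := by gcongr
    _ = (n : ℝ) ^ (-r) * ((n : ℝ) ^ (s * (1 - a) - r))⁻¹ := by
        rw [← Real.rpow_mul hn.le, ← Real.rpow_sub hn, ← Real.rpow_neg hn.le, ← Real.rpow_add hn]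
        congr 1
        ring
    _ ≤ (n : ℝ) ^ (-r) * κ := by
        gcongr
        rw [inv_le_iff_one_le_mul₀ (by positivity), mul_comm]
        exact h3
    _ = _ := mul_comm _ _

end Scale

/-! ### Logarithmic asymptotics -/

theorem tendsto_const_mul_rpow_neg (c : ℝ) {p p' : ℝ} (hp : p' < p) :
    Tendsto (fun n : ℕ => c * (n : ℝ) ^ (p' - p)) atTop (𝓝 0) := by
  have h1 := ((tendsto_rpow_neg_atTop (sub_pos.2 hp)).comp
    (tendsto_natCast_atTop_atTop (R := ℝ))).const_mul c
  rw [mul_zero] at h1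
  refine h1.congr fun n => ?_
  simp

theorem eventually_log_natCast_le_rpow {p : ℝ} (hp : 0 < p) :
    ∀ᶠ n : ℕ in atTop, Real.log n ≤ (n : ℝ) ^ p := by
  filter_upwards [tendsto_natCast_atTop_atTop.eventually
    ((isLittleO_log_rpow_atTop hp).def one_pos)] with n hn
  rwa [Real.norm_of_nonneg (Real.log_natCast_nonneg n), Real.norm_of_nonneg (by positivity),
    one_mul] at hn

section Model

variable {Ω : Type*} [MeasurableSpace Ω] {P : Measure Ω} [IsProbabilityMeasure P] {d : ℕ}
  {X : ℕ → Ω → (Fin d → ℤ)} {Y : (Fin d → ℤ) → Ω → ℝ} {q : ℝ} {D γ : ℝ → ℝ}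

theorem IsModel.eventually_log_ratio_le (h : IsModel P X Y) (hc : CenteringAssumption P (Y 0))
    (ht : TailAssumption P (Y 0) q D γ) {t : ℕ → ℝ} {ε r s p : ℝ} (hε : 0 < ε)
    (hpos : ∀ n, 1 ≤ n → 0 < t n) (hs : 0 < s) (hrs : r < s * (1 - q)) (hqs : q * s < p)
    (hlow : ∀ n : ℕ, 1 ≤ n → (n : ℝ) ^ (-r) ≤ t n) :
    ∀ᶠ n : ℕ in atTop, Real.log (P.real {ω | n * t n < rwrs X Y n ω} /
      P.real {ω | n * t n * (1 - ε) < Y 0 ω * localTime X n 0 ω}) ≤ 4 * (n : ℝ) ^ p := by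
  have hq := ht.q_pos
  have hp : 0 < p := (by positivity : 0 < q * s).trans hqs
  -- The bound is monotone in `ε`, so `ε < 1` may be assumed.
  set ε' := min ε (1 / 2) with hε'
  obtain ⟨κ, T, hκ, hT, hmain⟩ := h.exists_measure_rwrs_le hc ht (ε := ε')
    (lt_min hε (by norm_num)) ((min_le_right _ _).trans_lt (by norm_num))
  have hs' : Tendsto (fun n : ℕ => (n : ℝ) ^ s) atTop atTop :=
    (tendsto_rpow_atTop hs).comp tendsto_natCast_atTop_atTop
  have hG := hs'.eventually (ht.eventually_logTail_le_rpow (p := p / s) (by rwa [lt_div_iff₀ hs]))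
  have hG0 := hs'.eventually ht.eventually_logTail_pos
  have h3 : ∀ᶠ n : ℕ in atTop, Real.log 3 ≤ (n : ℝ) ^ p :=
    ((tendsto_rpow_atTop hp).comp tendsto_natCast_atTop_atTop).eventually_ge_atTop _
  filter_upwards [ht.eventually_slope_le hs hrs hκ, hs'.eventually_ge_atTop T, hG, hG0, h3,
    eventually_log_natCast_le_rpow hp, eventually_ge_atTop 1] with n hD hTn hG hG0 h3 hlogn hn
  have hn0 : (0 : ℝ) < n := by exact_mod_cast hn
  have hn1 : (1 : ℝ) ≤ n := by exact_mod_cast hn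
  have htn := hpos n hn
  set G := logTail P (Y 0) ((n : ℝ) ^ s) with hGdef
  have hGp : G ≤ (n : ℝ) ^ p := by
    rwa [← Real.rpow_mul hn0.le, mul_div_cancel₀ _ hs.ne'] at hG
  have hratio : P.real {ω | n * t n < rwrs X Y n ω} /
      P.real {ω | n * t n * (1 - ε) < Y 0 ω * localTime X n 0 ω} ≤
        3 * ((n : ℝ) * n * Real.exp G) := by
    rw [div_le_iff₀ (ht.measure_mul_localTime_pos hn _)]
    refine (hmain n (t n) _ hn htn hTn (hD.trans (by gcongr; exact hlow n hn))).trans ?_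
    have hE : 1 ≤ Real.exp G := Real.one_le_exp hG0.le
    have h4 : n * (n + 1 + Real.exp G) ≤ 3 * ((n : ℝ) * n * Real.exp G) := by
      have h5 : (n : ℝ) ≤ n * Real.exp G := le_mul_of_one_le_right hn0.le hE
      have h6 : Real.exp G ≤ n * Real.exp G := le_mul_of_one_le_left (by linarith) hn1
      nlinarith
    refine mul_le_mul h4 (measureReal_mono fun ω hω => ?_) measureReal_nonneg (by positivity)
    have hω' : n * t n * (1 - ε') < Y 0 ω * localTime X n 0 ω := hω
    refine lt_of_le_of_lt ?_ hω'
    have : 1 - ε ≤ 1 - ε' := by linarith [min_le_left ε (1 / 2)]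
    gcongr
  rcases (div_nonneg measureReal_nonneg measureReal_nonneg :
    0 ≤ P.real {ω | n * t n < rwrs X Y n ω} /
      P.real {ω | n * t n * (1 - ε) < Y 0 ω * localTime X n 0 ω}).eq_or_lt with h0 | h0
  · rw [← h0, Real.log_zero]
    positivity
  · refine (Real.log_le_log h0 hratio).trans ?_
    rw [Real.log_mul (by norm_num) (by positivity), Real.log_mul (by positivity) (by positivity),
      Real.log_mul (by positivity) (by positivity), Real.log_exp]
    linarith

theorem IsModel.eventually_le_log_ratio (h : IsModel P X Y) (hc : CenteringAssumption P (Y 0))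
    (ht : TailAssumption P (Y 0) q D γ) {t : ℕ → ℝ} {ε r p : ℝ} (hε : 0 < ε) (hr : 0 < r)
    (hp : 0 < p) (hlow : ∀ n : ℕ, 1 ≤ n → (n : ℝ) ^ (-r) ≤ t n) :
    ∀ᶠ n : ℕ in atTop, -(2 * r + 1) * (n : ℝ) ^ p ≤
      Real.log (P.real {ω | n * t n < rwrs X Y n ω} /
        P.real {ω | n * t n * (1 + ε) < Y 0 ω * localTime X n 0 ω}) := by
  set σ := ∫ ω, Y 0 ω ^ 2 ∂P with hσ
  have hσ0 : 0 ≤ σ := integral_nonneg fun ω => sq_nonneg _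
  filter_upwards [tendsto_natCast_atTop_atTop.eventually_ge_atTop (1 + σ / ε ^ 2),
    eventually_log_natCast_le_rpow hp, eventually_ge_atTop 1] with n h1 hlogn hn
  have hn0 : (0 : ℝ) < n := by exact_mod_cast hn
  have hn1 : (1 : ℝ) ≤ n := by exact_mod_cast hn
  have htn : 0 < t n := lt_of_lt_of_le (by positivity) (hlow n hn)
  have hden := ht.measure_mul_localTime_pos (X := X) hn (n * t n * (1 + ε))
  have hc1 : (n : ℝ) ^ (-(2 * r + 1)) ≤ (ε * t n) ^ 2 / ((ε * t n) ^ 2 + σ) := by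
    rw [Real.rpow_neg hn0.le, inv_le_comm₀ (by positivity) (by positivity), inv_div]
    have h2 : ((ε * t n) ^ 2 + σ) / (ε * t n) ^ 2 = 1 + σ / ε ^ 2 * (t n ^ 2)⁻¹ := by
      field_simp
    have h3 : (t n ^ 2)⁻¹ ≤ (n : ℝ) ^ (2 * r) := by
      rw [inv_le_comm₀ (by positivity) (by positivity), ← Real.rpow_neg hn0.le,
        show -(2 * r) = -r * 2 by ring, Real.rpow_mul hn0.le, Real.rpow_two]
      gcongr
      exact hlow n hn
    have h4 : 1 ≤ (n : ℝ) ^ (2 * r) := Real.one_le_rpow hn1 (by linarith)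
    have h5 : 0 ≤ σ / ε ^ 2 := by positivity
    rw [h2, Real.rpow_add hn0, Real.rpow_one]
    calc 1 + σ / ε ^ 2 * (t n ^ 2)⁻¹ ≤ (n : ℝ) ^ (2 * r) + σ / ε ^ 2 * (n : ℝ) ^ (2 * r) := by
          gcongr
      _ = (n : ℝ) ^ (2 * r) * (1 + σ / ε ^ 2) := by ring
      _ ≤ _ := by gcongr
  have hratio : (n : ℝ) ^ (-(2 * r + 1)) ≤ P.real {ω | n * t n < rwrs X Y n ω} /
      P.real {ω | n * t n * (1 + ε) < Y 0 ω * localTime X n 0 ω} := by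
    rw [le_div_iff₀ hden]
    exact le_trans (by gcongr) (h.measure_rwrs_ge hc hε hn htn)
  refine le_trans ?_ (Real.log_le_log (by positivity) hratio)
  rw [Real.log_rpow hn0]
  nlinarith

end Model

end RWRS

theorem proposition1p2 {Ω : Type*} [MeasurableSpace Ω] (P : Measure Ω) [IsProbabilityMeasure P]
    (d : ℕ) (hd : 1 ≤ d)
    (X : ℕ → Ω → (Fin d → ℤ)) (Y : (Fin d → ℤ) → Ω → ℝ)
    (hmodel : RWRS.IsModel P X Y) (hwalk : RWRS.WalkAssumption P X)
    (q : ℝ) (D γ : ℝ → ℝ)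
    (hcent : RWRS.CenteringAssumption P (Y 0)) (htail : RWRS.TailAssumption P (Y 0) q D γ)
    (t : ℕ → ℝ) (ht : RWRS.DeviationCondition d q t)
    (ε : ℝ) (hε : 0 < ε) :
    limsup (fun n : ℕ => ((1 / RWRS.beta d q D γ n (t n) *
        Real.log (P.real {ω | n * t n < RWRS.rwrs X Y n ω} /
          P.real {ω | n * t n * (1 - ε) < Y 0 ω * RWRS.localTime X n 0 ω}) : ℝ) : EReal)) atTop ≤ 0 ∧
    0 ≤ liminf (fun n : ℕ => ((1 / RWRS.beta d q D γ n (t n) *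
        Real.log (P.real {ω | n * t n < RWRS.rwrs X Y n ω} /
          P.real {ω | n * t n * (1 + ε) < Y 0 ω * RWRS.localTime X n 0 ω}) : ℝ) : EReal)) atTop := by
  obtain ⟨r, s, p, hr, hs, hrs, hqs, hlow, hbeta⟩ := htail.exists_exponents hd ht
  obtain ⟨p', hp1, hp2⟩ := exists_between hqs
  have hp0 : 0 < p' := (mul_pos htail.q_pos hs).trans hp1
  have hlim : ∀ c : ℝ,
      Tendsto (fun n : ℕ => ((c * (n : ℝ) ^ (p' - p) : ℝ) : EReal)) atTop (𝓝 0) := fun c =>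
    (continuous_coe_real_ereal.tendsto 0).comp (RWRS.tendsto_const_mul_rpow_neg c hp2)
  -- Both logarithms are `O(n ^ p')`, while the scale is at least `n ^ p` with `p > p'`.
  have hinv : ∀ᶠ n : ℕ in atTop, 0 ≤ 1 / RWRS.beta d q D γ n (t n) ∧
      1 / RWRS.beta d q D γ n (t n) * (n : ℝ) ^ p' ≤ (n : ℝ) ^ (p' - p) := by
    filter_upwards [hbeta, eventually_gt_atTop 0] with n hn hn0
    have hn0' : (0 : ℝ) < n := by exact_mod_cast hn0
    have hnp : 0 < (n : ℝ) ^ p := by positivity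
    refine ⟨(one_div_pos.2 (hnp.trans_le hn)).le, ?_⟩
    rw [Real.rpow_sub hn0', div_mul_eq_mul_div, one_mul]
    gcongr
  constructor
  · rw [← (hlim 4).limsup_eq]
    refine limsup_le_limsup ?_
    filter_upwards [hinv, hmodel.eventually_log_ratio_le hcent htail hε ht.pos hs hrs hp1 hlow]
      with n h1 h2
    rw [EReal.coe_le_coe_iff]
    calc _ ≤ 1 / RWRS.beta d q D γ n (t n) * (4 * (n : ℝ) ^ p') :=
          mul_le_mul_of_nonneg_left h2 h1.1
      _ = 4 * (1 / RWRS.beta d q D γ n (t n) * (n : ℝ) ^ p') := by ring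
      _ ≤ _ := mul_le_mul_of_nonneg_left h1.2 (by norm_num)
  · rw [← (hlim (-(2 * r + 1))).liminf_eq]
    refine liminf_le_liminf ?_
    filter_upwards [hinv, hmodel.eventually_le_log_ratio hcent htail hε hr hp0 hlow] with n h1 h2
    rw [EReal.coe_le_coe_iff]
    calc _ ≤ -(2 * r + 1) * (1 / RWRS.beta d q D γ n (t n) * (n : ℝ) ^ p') :=
          mul_le_mul_of_nonpos_left h1.2 (by linarith)
      _ = 1 / RWRS.beta d q D γ n (t n) * (-(2 * r + 1) * (n : ℝ) ^ p') := by ring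
      _ ≤ _ := mul_le_mul_of_nonneg_left h2 h1.1
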